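/- Let $\Phi$ be a (reduced) irreducible crystallographic root system spanning a finite-dimensional real vector space $V$, let $\langle x,\alpha^\vee\rangle$ denote the pairing of $x\in V$ with the coroot of $\alpha\in\Phi$ (so $\langle x,\alpha^\vee\rangle=2(x,\alpha)/(\alpha,\alpha)$ for an inner product invariant under the Weyl group), let $\Delta=\{\alpha_1,\dots,\alpha_n\}$ be a simple system and $\Phi^+$ the corresponding set of positive roots. For $\alpha\in\Phi$ and $k\in\mathbb Z$ put $s_{\alpha,k}(x)=x-(\langle x,\alpha^\vee\rangle-k)\alpha$, and let $W_a$ be the group of affine transformations of $V$ generated by all the $s_{\alpha,k}$. Let $A_e=\{x\in V: 0<\langle x,\alpha^\vee\rangle<1\ \forall\alpha\in\Phi^+\}$ and $A_w=wA_e$ for $w\in W_a$. For $\theta\in\Phi^+$ write $\theta^\vee=\sum_{i=1}^n m_i\alpha_i^\vee$ and put $h(\theta^\vee)=\sum_i m_i$, $I_\theta=\{0,1,\dots,h(\theta^\vee)-1\}$ and $P_\theta=\sum_i m_iX_{\alpha_i}\in\mathbb Z[X_{\Phi^+}]=\mathbb Z[X_\alpha:\alpha\in\Phi^+]$. For $l\in\mathbb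 Z$ let $P_\theta[l]=P_\theta+l-X_\theta$. For an ideal $I$ of polynomials in the variables $X_\alpha$ $(\alpha\in\Phi^+)$ let $V(I)\subseteq\mathbb R^{\Phi^+}$ be its set of real zeros, and for $Y\subseteq\mathbb R^{\Phi^+}$ let $Y(\mathbb Z)$ be the set of points of $Y$ with integer coordinates. Let $$X_{W_a}=V\Big(\sum_{\alpha\in\Phi^+}\Big\langle\prod_{l\in I_\alpha}P_\alpha[l]\Big\rangle\Big),\qquad X_{W_a}[\lambda]=V\big(\langle P_\alpha[\lambda_\alpha]:\alpha\in\Phi^+\rangle\big)\quad(\lambda\in\mathbb Z^{\Phi^+}).$$ A vector $\lambda\in\mathbb Z^{\Phi^+}$ is called admissible if $\lambda_\alpha\in I_\alpha$ for all $\alpha\in\Phi^+$, and admitted if it is admissible and $\lambda_\alpha+\lambda_\beta\le\lambda_\gamma\le\lambda_\alpha+\lambda_\beta+1$ for all $\alpha,\beta,\gamma\in\Phi^+$ with $\gamma^\vee=\alpha^\vee+\beta^\vee$. The Shi variety is $\widehat X_{W_a}=\bigcup_{\lambda\text{ admitted}}X_{W_a}[\lambda]$. Theorem. (1) For every $w\in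 W_a$ there is exactly one family of integers $(k(w,\alpha))_{\alpha\in\Phi^+}$ such that $A_w=\{x\in V: k(w,\alpha)<\langle x,\alpha^\vee\rangle<k(w,\alpha)+1\ \forall\alpha\in\Phi^+\}$. The map $\iota:w\mapsto(k(w,\alpha))_{\alpha\in\Phi^+}$ takes its values in $X_{W_a}(\mathbb Z)$. The sets $X_{W_a}[\lambda]$, $\lambda$ admitted, are pairwise disjoint, their union $\widehat X_{W_a}$ is an algebraic subset of $\mathbb R^{\Phi^+}$ contained in $X_{W_a}$, and $\iota$ is a bijection from $W_a$ onto $\widehat X_{W_a}(\mathbb Z)$. (2) Let $\widetilde\alpha=\sum_{i=1}^n c_i\alpha_i$ be the highest root of $\Phi$ (the root such that $\widetilde\alpha-\beta$ is a linear combination of simple roots with nonnegative integer coefficients for every $\beta\in\Phi$). The number of irreducible components of $\widehat X_{W_a}$ (for the Zariski topology) is finite and equal to $n!\prod_{i=1}^n c_i$. -/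

import Mathlib

namespace ShiVariety

section Zariski

variable {σ A : Type*} [CommRing A] [Algebra A ℝ]

/-- `V(I) ⊆ ℝ^σ`: the common real zeros of an ideal `I` of polynomials with coefficients in `A`
(used for `A = ℤ` and `A = ℝ`). -/
def zeroSet (I : Ideal (MvPolynomial σ A)) : Set (σ → ℝ) :=
  {x | ∀ p ∈ I, MvPolynomial.aeval x p = 0}

theorem zeroSet_top (σ : Type*) :
    zeroSet (⊤ : Ideal (MvPolynomial σ ℝ)) = ∅ := by
  refine Set.eq_empty_of_forall_notMem fun x hx => ?_
  have h := hx 1 Submodule.mem_top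
  rw [map_one] at h
  exact one_ne_zero h

theorem zeroSet_iSup {σ κ : Type*} (I : κ → Ideal (MvPolynomial σ ℝ)) :
    zeroSet (⨆ i, I i) = ⋂ i, zeroSet (I i) := by
  ext x
  rw [Set.mem_iInter]
  constructor
  · exact fun hx i p hp => hx p (le_iSup I i hp)
  · intro hx p hp
    have hle : ⨆ i, I i ≤ RingHom.ker (MvPolynomial.aeval (R := ℝ) x) :=
      iSup_le fun i q hq => RingHom.mem_ker.mpr (hx i q hq)
    exact RingHom.mem_ker.mp (hle hp)

theorem zeroSet_mul {σ : Type*} (I J : Ideal (MvPolynomial σ ℝ)) :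
    zeroSet (I * J) = zeroSet I ∪ zeroSet J := by
  ext x
  rw [Set.mem_union]
  constructor
  · intro hx
    by_contra! hcon
    obtain ⟨h1, h2⟩ := hcon
    refine h1 fun p hp => by_contra fun hpx => h2 fun q hq => ?_
    have h := hx (p * q) (Ideal.mul_mem_mul hp hq)
    rw [map_mul] at h
    exact (mul_eq_zero.mp h).resolve_left hpx
  · rintro (hx | hx) p hp
    · exact hx p ((Ideal.mul_le_inf.trans inf_le_left) hp)
    · exact hx p ((Ideal.mul_le_inf.trans inf_le_right) hp)

/-- The Zariski topology on `ℝ^σ`: the closed sets are the `V(I)`, `I` an ideal of `ℝ[X_σ]`. -/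
abbrev zariskiTopology (σ : Type*) : TopologicalSpace (σ → ℝ) :=
  TopologicalSpace.ofClosed (Set.range (zeroSet : Ideal (MvPolynomial σ ℝ) → Set (σ → ℝ)))
    ⟨⊤, zeroSet_top σ⟩
    (fun S hS => by
      choose I hI using fun Y : S => hS Y.2
      exact ⟨⨆ Y, I Y, by rw [zeroSet_iSup, Set.sInter_eq_iInter]; exact Set.iInter_congr hI⟩)
    (by
      rintro _ ⟨I, rfl⟩ _ ⟨J, rfl⟩
      exact ⟨I * J, zeroSet_mul I J⟩)

/-- The irreducible components of `Y ⊆ ℝ^σ`, for the topology induced on `Y` by the Zariski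
topology. -/
def components (Y : Set (σ → ℝ)) : Set (Set Y) :=
  @irreducibleComponents Y (TopologicalSpace.induced Subtype.val (zariskiTopology σ))

/-- `Y(ℤ)`: the points of `Y ⊆ ℝ^σ` all of whose coordinates are integers. -/
def integralPoints (Y : Set (σ → ℝ)) : Set (σ → ℝ) :=
  {x ∈ Y | ∀ a, ∃ z : ℤ, x a = z}

end Zariski

variable {ι M N : Type*} [AddCommGroup M] [Module ℝ M] [AddCommGroup N] [Module ℝ N]

section AffineWeylGroup

variable (P : RootPairing ι ℝ M N)

/-- The affine reflection `s_{α,k} : x ↦ x - (⟨x, α^∨⟩ - k) α`. -/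
noncomputable def affineReflection (α : ι) (k : ℤ) : M ≃ᵃ[ℝ] M :=
  (P.reflection α).toAffineEquiv.trans (AffineEquiv.constVAdd ℝ M ((k : ℝ) • P.root α))

theorem affineReflection_apply (α : ι) (k : ℤ) (x : M) :
    affineReflection P α k x = x - (P.coroot' α x - k) • P.root α := by
  simp only [affineReflection, AffineEquiv.trans_apply, LinearEquiv.coe_toAffineEquiv,
    AffineEquiv.constVAdd_apply, P.reflection_apply, vadd_eq_add]
  module

/-- The affine Weyl group `W_a`, generated by all `s_{α,k}` with `α ∈ Φ`, `k ∈ ℤ`. -/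
def affineWeylGroup : Subgroup (M ≃ᵃ[ℝ] M) :=
  Subgroup.closure {s | ∃ (α : ι) (k : ℤ), s = affineReflection P α k}

/-- The strip `{x | k < ⟨x, α^∨⟩ < k + 1}`. -/
def strip (α : ι) (k : ℤ) : Set M :=
  {x | (k : ℝ) < P.coroot' α x ∧ P.coroot' α x < k + 1}

end AffineWeylGroup

section Base

variable {P : RootPairing ι ℝ M N} (b : P.Base)

/-- (The index set of) the positive roots `Φ⁺`. -/
abbrev PosRoot : Type _ := {α : ι // b.IsPos α}

/-- A simple root, as a positive root. -/
def simple (i : b.support) : PosRoot b := ⟨i, RootPairing.Base.isPos_of_mem_support i.2⟩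

/-- The fundamental alcove `A_e`. -/
def fundamentalAlcove : Set M := ⋂ α : PosRoot b, strip P α 0

/-- The alcove `A_w = w A_e`. -/
def alcove (w : affineWeylGroup P) : Set M := (w : M ≃ᵃ[ℝ] M) '' fundamentalAlcove b

/-- `k` is a family of integers such that `A_w` is the intersection over `α ∈ Φ⁺` of the strips
`{x | k_α < ⟨x, α^∨⟩ < k_α + 1}`. -/
def IsShiVector (w : affineWeylGroup P) (k : PosRoot b → ℤ) : Prop :=
  alcove b w = ⋂ α : PosRoot b, strip P α (k α)

/-- The coefficients `k(w, α)`, `α ∈ Φ⁺`: the family `k` with `IsShiVector b w k`. (That there is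
exactly one such family is part of the theorem.) -/
noncomputable def shiCoeff (w : affineWeylGroup P) : PosRoot b → ℤ :=
  Classical.epsilon (IsShiVector b w)

/-- `w ↦ (k(w, α))_{α ∈ Φ⁺}`, as a point of `ℝ^{Φ⁺}`. -/
noncomputable def shiMap (w : affineWeylGroup P) : PosRoot b → ℝ :=
  fun α => (shiCoeff b w α : ℝ)

/-- The integers `a_i` in `θ = ∑ i, a_i α_i`, for `θ ∈ Φ` and `α_i` the simple roots. -/
noncomputable def rootCoeff (θ : ι) (i : b.support) : ℤ :=
  b.toWeightBasisInt.repr (P.rootSpanMem ℤ θ) i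

/-- The integers `m_i` in `θ^∨ = ∑ i, m_i α_i^∨`, for `θ ∈ Φ` and `α_i` the simple roots. -/
noncomputable def corootCoeff (θ : ι) (i : b.support) : ℤ :=
  rootCoeff b.flip θ i

theorem root_eq_sum (θ : ι) :
    P.root θ = ∑ i : b.support, rootCoeff b θ i • P.root i := by
  have h := congrArg (Submodule.subtype _) (b.toWeightBasisInt.sum_repr (P.rootSpanMem ℤ θ))
  simp only [map_sum, map_smul, Submodule.subtype_apply,
    RootPairing.Base.coe_toWeightBasisInt_apply] at h
  exact h.symm

theorem coroot_eq_sum (θ : ι) :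
    P.coroot θ = ∑ i : b.support, corootCoeff b θ i • P.coroot i :=
  root_eq_sum b.flip θ

theorem rootCoeff_simple [DecidableEq b.support] (i j : b.support) :
    rootCoeff b i j = if i = j then 1 else 0 := by
  have e : P.rootSpanMem ℤ i = b.toWeightBasisInt i := by
    apply Subtype.ext
    rw [RootPairing.Base.coe_toWeightBasisInt_apply]
  rw [rootCoeff, e, Module.Basis.repr_self, Finsupp.single_apply]

theorem rootCoeff_add (α β θ : ι) (h : P.root θ = P.root α + P.root β) (i : b.support) :
    rootCoeff b θ i = rootCoeff b α i + rootCoeff b β i := by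
  have e : P.rootSpanMem ℤ θ = P.rootSpanMem ℤ α + P.rootSpanMem ℤ β := Subtype.ext h
  rw [rootCoeff, e, map_add, Finsupp.add_apply, rootCoeff, rootCoeff]

/-- The height `h(θ^∨)` of the coroot of `θ`. -/
noncomputable def corootHeight (θ : ι) : ℤ := ∑ i : b.support, corootCoeff b θ i

/-- The integer interval `I_θ = [0, h(θ^∨) - 1]`. -/
noncomputable def interval (θ : PosRoot b) : Finset ℤ := Finset.Icc 0 (corootHeight b θ - 1)

/-- The linear polynomial `P_θ`: it is `∑ i, m_i X_{α_i}` where `θ^∨ = ∑ i, m_i α_i^∨`; that is,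
`P_θ = X_θ` for `θ` simple, and `P_θ = P_α + P_β` whenever `θ^∨ = α^∨ + β^∨`
(see the next two lemmas). -/
noncomputable def linPoly (θ : PosRoot b) : MvPolynomial (PosRoot b) ℤ :=
  ∑ i : b.support, MvPolynomial.C (corootCoeff b θ i) * MvPolynomial.X (simple b i)

theorem linPoly_simple (i : b.support) : linPoly b (simple b i) = MvPolynomial.X (simple b i) := by
  classical
  have h : ∀ j : b.support, corootCoeff b (simple b i).1 j = if i = j then 1 else 0 :=
    fun j => rootCoeff_simple b.flip i j
  simp [linPoly, h]

theorem linPoly_add (α β θ : PosRoot b) (h : P.coroot θ = P.coroot α + P.coroot β) :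
    linPoly b θ = linPoly b α + linPoly b β := by
  have hc : ∀ i, corootCoeff b θ.1 i = corootCoeff b α.1 i + corootCoeff b β.1 i :=
    fun i => rootCoeff_add b.flip α.1 β.1 θ.1 h i
  simp [linPoly, hc, add_mul, Finset.sum_add_distrib]

/-- The polynomial `P_θ[l] = P_θ + l - X_θ`. -/
noncomputable def shiPoly (θ : PosRoot b) (l : ℤ) : MvPolynomial (PosRoot b) ℤ :=
  linPoly b θ + MvPolynomial.C l - MvPolynomial.X θ

/-- The ideal `J_{W_a}` of `ℤ[X_{Φ⁺}]`. -/
noncomputable def idealJ : Ideal (MvPolynomial (PosRoot b) ℤ) :=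
  ⨆ α : PosRoot b, Ideal.span {∏ l ∈ interval b α, shiPoly b α l}

/-- The variety `X_{W_a} = V(J_{W_a})`. -/
noncomputable def varX : Set (PosRoot b → ℝ) := zeroSet (idealJ b)

/-- `v` is admissible: `v_α ∈ I_α` for all `α ∈ Φ⁺`. -/
def IsAdmissible (v : PosRoot b → ℤ) : Prop := ∀ α, v α ∈ interval b α

/-- Shi's system of inequalities: `v_α + v_β ≤ v_γ ≤ v_α + v_β + 1` for all `α, β, γ ∈ Φ⁺` with
`γ^∨ = α^∨ + β^∨`. -/
def SatisfiesShiSystem (v : PosRoot b → ℤ) : Prop :=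
  ∀ α β γ : PosRoot b, P.coroot γ = P.coroot α + P.coroot β →
    v α + v β ≤ v γ ∧ v γ ≤ v α + v β + 1

/-- `v` is admitted: it is admissible and satisfies Shi's system of inequalities. -/
def IsAdmitted (v : PosRoot b → ℤ) : Prop := IsAdmissible b v ∧ SatisfiesShiSystem b v

/-- The ideal `J_{W_a}[v]`, generated by the `P_α[v_α]`, `α ∈ Φ⁺`. -/
noncomputable def idealJAt (v : PosRoot b → ℤ) : Ideal (MvPolynomial (PosRoot b) ℤ) :=
  Ideal.span {p | ∃ α : PosRoot b, p = shiPoly b α (v α)}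

/-- The variety `X_{W_a}[v] = V(J_{W_a}[v])`. -/
noncomputable def varXAt (v : PosRoot b → ℤ) : Set (PosRoot b → ℝ) := zeroSet (idealJAt b v)

/-- The Shi variety: the union of the `X_{W_a}[v]` over all admitted vectors `v`. -/
noncomputable def shiVariety : Set (PosRoot b → ℝ) :=
  ⋃ v ∈ {v : PosRoot b → ℤ | IsAdmitted b v}, varXAt b v

/-- `θ` is the highest root: for every root `β`, `θ - β` is a (possibly empty) sum of simple roots. -/
def IsHighestRoot (θ : ι) : Prop :=
  ∀ β : ι, P.root θ - P.root β ∈ AddSubmonoid.closure (P.root '' b.support)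

end Base

end ShiVariety

/-! Record an alcove by the integers K_i = ⌊⟨x, i^∨⟩⌋ over all roots i, not only the positive ones.
Such a family satisfies K_{-i} = -1 - K_i and Shi's inequalities (`IsAlcoveFamily`), and W_a acts on
these families because each element permutes the functionals ⟨·, i^∨⟩ up to integer shifts.

The core is that this action is simply transitive. A family other than that of A_e is separated from
it by a wall of A_e (`exists_wall`), and reflecting in that wall lowers an ℓ¹ distance; this gives
transitivity (`exists_mem_wallGroup`). A similar descent shows that the wall reflections generate
W_a (`refl_mem`), and an exchange argument on words in them (`IsWallList.exchange`) makes
stabilizers trivial (`act_baseFamily_injective`).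

Each X[λ] is the graph of an affine map over the coordinates at the simple roots. Subtracting the
linear part turns an integral solution of Shi's system into an admitted vector, so the integral
points of the Shi variety are exactly these solutions (`mem_integralPoints_shiVariety`), and ι is
bijective. The finitely many X[λ] are closed, irreducible and disjoint, hence are the components.
Their number is the number of alcoves in the box 0 < ⟨x, α_i^∨⟩ < 1 (`BoxFamily`).

The box has volume 1 in the coordinates ⟨x, α_i^∨⟩ and W_a preserves volume, so the number is 1 /
vol A_e. When some coroot dominates all others coefficientwise, A_e is a simplex and the number is
n! times the product of the coefficients of that coroot (`card_boxFamily_eq`). The theorem asks for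
the highest root instead. But the number of box alcoves times |det Cartan| is the order of the
finite reflection group (`card_boxFamily_mul`), and duality changes neither of the last two; so the
count may be made in the dual root system (`card_boxFamily_flip`). -/

open Topology MeasureTheory

namespace ShiVariety

variable {ι M N : Type*} [AddCommGroup M] [Module ℝ M] [AddCommGroup N] [Module ℝ N]

/-! ### Elements of the affine Weyl group as permutations of the coroots with integer shifts. -/

section Symmetries

variable (P : RootPairing ι ℝ M N)

theorem coroot'_injective : Function.Injective P.coroot' := fun i j h =>
  P.coroot.injective (P.toLinearMap.flip.toPerfPair.injective (by ext x; exact congr($h x)))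

theorem coroot'_self (i : ι) : P.coroot' i (P.root i) = 2 := P.root_coroot_two i

theorem coroot'_root [P.IsCrystallographic] (i j : ι) :
    P.coroot' i (P.root j) = P.pairingIn ℤ j i := by
  rw [P.root_coroot'_eq_pairing, ← P.algebraMap_pairingIn ℤ]
  simp

theorem coroot'_separates [P.IsRootSystem] {x y : M} (h : ∀ i, P.coroot' i x = P.coroot' i y) :
    x = y := by
  refine P.toPerfPair.injective ?_
  have hs : Submodule.span ℝ (Set.range P.coroot) = ⊤ := RootPairing.IsRootSystem.span_coroot_eq_top
  refine LinearMap.ext_on hs ?_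
  rintro _ ⟨i, rfl⟩
  exact h i

/-- An affine automorphism `g` such that `⟨g x, i^∨⟩ = ⟨x, (π i)^∨⟩ + c i` for all `i`. -/
structure IsAffineSymmetry (g : M ≃ᵃ[ℝ] M) (π : Equiv.Perm ι) (c : ι → ℤ) : Prop where
  coroot_apply : ∀ i x, P.coroot' i (g x) = P.coroot' (π i) x + c i
  linear_root : ∀ i, g.linear (P.root (π i)) = P.root i
  perm_mem : π ∈ Subgroup.closure (Set.range P.reflectionPerm)
  lattice : ∀ x, g x ∈ P.rootSpan ℤ ↔ x ∈ P.rootSpan ℤ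

variable {P}

theorem IsAffineSymmetry.one : IsAffineSymmetry P 1 1 0 where
  coroot_apply i x := by simp
  linear_root i := by simp [AffineEquiv.one_def]
  perm_mem := one_mem _
  lattice x := Iff.rfl

theorem IsAffineSymmetry.mul {g h : M ≃ᵃ[ℝ] M} {π ρ : Equiv.Perm ι} {c d : ι → ℤ}
    (hg : IsAffineSymmetry P g π c) (hh : IsAffineSymmetry P h ρ d) :
    IsAffineSymmetry P (g * h) (ρ * π) (fun i => d (π i) + c i) where
  coroot_apply i x := by
    rw [AffineEquiv.mul_def, AffineEquiv.trans_apply, hg.coroot_apply, hh.coroot_apply]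
    push_cast
    rw [Function.comp_apply]
    ring
  linear_root i := by
    change g.linear (h.linear (P.root (ρ (π i)))) = _
    rw [hh.linear_root, hg.linear_root]
  perm_mem := mul_mem hh.perm_mem hg.perm_mem
  lattice x := (hg.lattice (h x)).trans (hh.lattice x)

theorem IsAffineSymmetry.inv {g : M ≃ᵃ[ℝ] M} {π : Equiv.Perm ι} {c : ι → ℤ}
    (hg : IsAffineSymmetry P g π c) :
    IsAffineSymmetry P g⁻¹ π⁻¹ (fun i => -c (π⁻¹ i)) where
  coroot_apply i x := by
    have h := hg.coroot_apply (π⁻¹ i) (g⁻¹ x)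
    have e : g (g⁻¹ x) = x := AffineEquiv.apply_symm_apply g x
    rw [e, show π (π⁻¹ i) = i from π.apply_symm_apply i] at h
    push_cast
    linarith
  linear_root i := by
    have h := hg.linear_root (π⁻¹ i)
    rw [show π (π⁻¹ i) = i from π.apply_symm_apply i] at h
    rw [← h]
    exact g.linear.symm_apply_apply _
  perm_mem := inv_mem hg.perm_mem
  lattice x := by
    have h := hg.lattice (g⁻¹ x)
    have e : g (g⁻¹ x) = x := AffineEquiv.apply_symm_apply g x
    rw [e] at h
    exact h.symm

variable [P.IsCrystallographic]

theorem coroot'_reflectionPerm_apply (a i : ι) (x : M) :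
    P.coroot' (P.reflectionPerm a i) x = P.coroot' i x - P.coroot' a x * P.pairingIn ℤ a i := by
  rw [← coroot'_root, P.coroot'_reflectionPerm]
  simp [P.reflection_apply]

theorem isAffineSymmetry_affineReflection (a : ι) (m : ℤ) :
    IsAffineSymmetry P (affineReflection P a m) (P.reflectionPerm a)
      (fun i => m * P.pairingIn ℤ a i) := by
  have hinv : ∀ x, affineReflection P a m (affineReflection P a m x) = x := fun x => by
    simp only [affineReflection_apply, map_sub, map_smul, coroot'_self, smul_eq_mul]
    module
  have hlat : ∀ x ∈ P.rootSpan ℤ, affineReflection P a m x ∈ P.rootSpan ℤ := fun x hx => by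
    obtain ⟨z, hz⟩ := P.coroot'_apply_apply_mem_of_mem_span ℤ hx a
    rw [affineReflection_apply]
    refine sub_mem hx ?_
    have e : (P.coroot' a x - m) • P.root a = (z - m) • P.root a := by
      rw [← Int.cast_smul_eq_zsmul ℝ (z - m), ← hz]
      simp
    rw [e]
    exact Submodule.smul_mem _ _ (Submodule.subset_span ⟨a, rfl⟩)
  refine ⟨fun i x => ?_, fun i => ?_, Subgroup.subset_closure ⟨a, rfl⟩,
    fun x => ⟨fun h => ?_, hlat x⟩⟩
  · rw [coroot'_reflectionPerm_apply, affineReflection_apply, map_sub, map_smul, coroot'_root]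
    push_cast
    simp only [smul_eq_mul]
    ring
  · change P.reflection a _ = _
    rw [P.root_reflectionPerm, P.reflection_same]
  · rw [← hinv x]
    exact hlat _ h

theorem exists_isAffineSymmetry {g : M ≃ᵃ[ℝ] M} (hg : g ∈ affineWeylGroup P) :
    ∃ π c, IsAffineSymmetry P g π c := by
  induction hg using Subgroup.closure_induction with
  | mem _ h =>
    obtain ⟨a, m, rfl⟩ := h
    exact ⟨_, _, isAffineSymmetry_affineReflection a m⟩
  | one => exact ⟨_, _, .one⟩
  | mul _ _ _ _ h₁ h₂ =>
    obtain ⟨_, _, h₁⟩ := h₁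
    obtain ⟨_, _, h₂⟩ := h₂
    exact ⟨_, _, h₁.mul h₂⟩
  | inv _ _ h =>
    obtain ⟨_, _, h⟩ := h
    exact ⟨_, _, h.inv⟩

omit [P.IsCrystallographic] in
theorem IsAffineSymmetry.shift_eq {g : M ≃ᵃ[ℝ] M} {π : Equiv.Perm ι} {c : ι → ℤ}
    (hg : IsAffineSymmetry P g π c) (i : ι) : (c i : ℝ) = P.coroot' i (g 0) := by
  rw [hg.coroot_apply, map_zero, zero_add]

omit [P.IsCrystallographic] in
theorem IsAffineSymmetry.unique {g : M ≃ᵃ[ℝ] M} {π ρ : Equiv.Perm ι} {c d : ι → ℤ}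
    (h₁ : IsAffineSymmetry P g π c) (h₂ : IsAffineSymmetry P g ρ d) : π = ρ ∧ c = d := by
  have hc : c = d := by
    funext i
    have h := (h₁.shift_eq i).trans (h₂.shift_eq i).symm
    exact_mod_cast h
  refine ⟨Equiv.ext fun i => coroot'_injective P (LinearMap.ext fun x => ?_), hc⟩
  have h := (h₁.coroot_apply i x).symm.trans (h₂.coroot_apply i x)
  rwa [hc, add_left_inj] at h

omit [P.IsCrystallographic] in
theorem IsAffineSymmetry.ext [P.IsRootSystem] {g h : M ≃ᵃ[ℝ] M} {π : Equiv.Perm ι} {c : ι → ℤ}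
    (hg : IsAffineSymmetry P g π c) (hh : IsAffineSymmetry P h π c) : g = h :=
  AffineEquiv.ext fun x => coroot'_separates P fun i => by rw [hg.coroot_apply, hh.coroot_apply]

/-- The permutation of the roots attached to an element of the affine Weyl group
(contravariantly). -/
noncomputable def indexPerm (w : affineWeylGroup P) : Equiv.Perm ι :=
  (exists_isAffineSymmetry w.2).choose

/-- The integers `⟨w 0, i^∨⟩`. -/
noncomputable def shift (w : affineWeylGroup P) : ι → ℤ :=
  (exists_isAffineSymmetry w.2).choose_spec.choose

theorem isAffineSymmetry (w : affineWeylGroup P) :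
    IsAffineSymmetry P w (indexPerm w) (shift w) :=
  (exists_isAffineSymmetry w.2).choose_spec.choose_spec

theorem indexPerm_mul (v w : affineWeylGroup P) : indexPerm (v * w) = indexPerm w * indexPerm v :=
  ((isAffineSymmetry (v * w)).unique ((isAffineSymmetry v).mul (isAffineSymmetry w))).1

theorem shift_mul (v w : affineWeylGroup P) (i : ι) :
    shift (v * w) i = shift w (indexPerm v i) + shift v i :=
  congrFun ((isAffineSymmetry (v * w)).unique
    ((isAffineSymmetry v).mul (isAffineSymmetry w))).2 i

theorem indexPerm_one : indexPerm (1 : affineWeylGroup P) = 1 :=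
  ((isAffineSymmetry (1 : affineWeylGroup P)).unique .one).1

theorem shift_one : shift (1 : affineWeylGroup P) = 0 :=
  ((isAffineSymmetry (1 : affineWeylGroup P)).unique .one).2

/-- The action of the affine Weyl group on families of integers indexed by the roots. -/
noncomputable def act (w : affineWeylGroup P) (K : ι → ℤ) : ι → ℤ :=
  fun i => K (indexPerm w i) + shift w i

theorem act_mul (v w : affineWeylGroup P) (K : ι → ℤ) : act (v * w) K = act v (act w K) := by
  funext i
  simp only [act, indexPerm_mul, shift_mul, Equiv.Perm.mul_apply]
  ring

theorem act_one (K : ι → ℤ) : act (1 : affineWeylGroup P) K = K := by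
  funext i
  simp [act, indexPerm_one, shift_one]

theorem act_inv_act (w : affineWeylGroup P) (K : ι → ℤ) : act w⁻¹ (act w K) = K := by
  rw [← act_mul, inv_mul_cancel, act_one]

variable (P) in
/-- The affine reflection `s_{a,m}` as an element of the affine Weyl group. -/
noncomputable def refl (a : ι) (m : ℤ) : affineWeylGroup P :=
  ⟨affineReflection P a m, Subgroup.subset_closure ⟨a, m, rfl⟩⟩

theorem indexPerm_refl (a : ι) (m : ℤ) : indexPerm (refl P a m) = P.reflectionPerm a :=
  ((isAffineSymmetry (refl P a m)).unique (isAffineSymmetry_affineReflection a m)).1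

theorem shift_refl (a : ι) (m : ℤ) (i : ι) : shift (refl P a m) i = m * P.pairingIn ℤ a i :=
  congrFun ((isAffineSymmetry (refl P a m)).unique (isAffineSymmetry_affineReflection a m)).2 i

theorem act_refl (a : ι) (m : ℤ) (K : ι → ℤ) (i : ι) :
    act (refl P a m) K i = K (P.reflectionPerm a i) + m * P.pairingIn ℤ a i := by
  rw [act, indexPerm_refl, shift_refl]

theorem affineWeylGroup_ext [P.IsRootSystem] {v w : affineWeylGroup P}
    (h₁ : indexPerm v = indexPerm w) (h₂ : shift v = shift w) : v = w := by
  have h := isAffineSymmetry w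
  rw [← h₁, ← h₂] at h
  exact Subtype.ext ((isAffineSymmetry v).ext h)

theorem refl_mul_self [P.IsRootSystem] (a : ι) (m : ℤ) : refl P a m * refl P a m = 1 := by
  refine affineWeylGroup_ext ?_ ?_
  · rw [indexPerm_mul, indexPerm_refl, indexPerm_one, ← sq, P.reflectionPerm_sq]
  · funext i
    rw [shift_mul, indexPerm_refl, shift_refl, shift_refl, shift_one,
      P.pairingIn_reflectionPerm, P.pairingIn_reflectionPerm_self_left]
    simp

/-- Evaluate the symmetry rule at a root and cancel the shift, which is the value at the image of 0.
-/
theorem pairingIn_indexPerm (w : affineWeylGroup P) (i j : ι) :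
    P.pairingIn ℤ (indexPerm w i) (indexPerm w j) = P.pairingIn ℤ i j := by
  have h := isAffineSymmetry w
  have h₁ := h.coroot_apply j (P.root (indexPerm w i))
  have e : (w : M ≃ᵃ[ℝ] M) (P.root (indexPerm w i)) = P.root i + (w : M ≃ᵃ[ℝ] M) 0 := by
    have h₂ := (w : M ≃ᵃ[ℝ] M).map_vadd 0 (P.root (indexPerm w i))
    simpa [h.linear_root] using h₂
  rw [e, map_add, ← h.shift_eq, coroot'_root, coroot'_root] at h₁
  have h₃ := add_right_cancel h₁
  exact_mod_cast h₃.symm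

/-- A reflection is conjugated to a reflection. -/
theorem conj_refl [P.IsRootSystem] (w : affineWeylGroup P) (a : ι) (m : ℤ) :
    w * refl P (indexPerm w a) m * w⁻¹ = refl P a (m + shift w a) := by
  rw [mul_inv_eq_iff_eq_mul]
  refine Subtype.ext (AffineEquiv.ext fun x => coroot'_separates P fun i => ?_)
  have h := isAffineSymmetry w
  change P.coroot' i ((w : M ≃ᵃ[ℝ] M) (affineReflection P (indexPerm w a) m x)) =
    P.coroot' i (affineReflection P a (m + shift w a) ((w : M ≃ᵃ[ℝ] M) x))
  rw [affineReflection_apply, h.coroot_apply, affineReflection_apply, map_sub, map_sub, map_smul,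
    map_smul, h.coroot_apply, h.coroot_apply, coroot'_root, coroot'_root, pairingIn_indexPerm]
  push_cast
  simp only [smul_eq_mul]
  ring

end Symmetries

end ShiVariety

namespace ShiVariety

variable {ι M N : Type*} [AddCommGroup M] [Module ℝ M] [AddCommGroup N] [Module ℝ N]
variable {P : RootPairing ι ℝ M N}

/-! ### Opposite roots, written `P.reflectionPerm i i`, and positivity under duality. -/

section Negatives

theorem coroot_reflectionPerm_self (i : ι) : P.coroot (P.reflectionPerm i i) = -P.coroot i := by
  rw [P.coroot_reflectionPerm, P.coreflection_apply_self]

theorem root_reflectionPerm_self (i : ι) : P.root (P.reflectionPerm i i) = -P.root i := by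
  rw [P.root_reflectionPerm, P.reflection_apply_self]

theorem coroot_eq_add_iff (i j l : ι) : P.coroot l = P.coroot i + P.coroot j ↔
    ∀ x, P.coroot' l x = P.coroot' i x + P.coroot' j x := by
  refine ⟨fun h x => by simp [h], fun h => P.toLinearMap.flip.toPerfPair.injective ?_⟩
  ext x
  simpa using h x

theorem reflectionPerm_self_self (i : ι) :
    P.reflectionPerm (P.reflectionPerm i i) (P.reflectionPerm i i) = i :=
  P.coroot.injective (by rw [coroot_reflectionPerm_self, coroot_reflectionPerm_self, neg_neg])

theorem coroot'_reflectionPerm_self (i : ι) (x : M) :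
    P.coroot' (P.reflectionPerm i i) x = -P.coroot' i x := by
  simp

theorem isPos_reflectionPerm_self (b : P.Base) (i : ι) :
    b.IsPos (P.reflectionPerm i i) ↔ ¬ b.IsPos i :=
  RootPairing.Base.IsPos.neg_iff_not b i

theorem eq_or_eq_reflectionPerm_self [P.IsReduced] {i j : ι}
    (h : ¬ LinearIndependent ℝ ![P.root i, P.root j]) :
    i = j ∨ i = P.reflectionPerm j j := by
  rcases RootPairing.IsReduced.eq_or_eq_neg i j h with h | h
  · exact .inl (P.root.injective h)
  · exact .inr (P.root.injective (h.trans (root_reflectionPerm_self j).symm))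

/-- Both notions of positivity hold at simple roots, are exchanged by negation, and are unaffected
by a simple reflection s_j away from ±j. All roots are reached from the simple ones by these
operations. -/
theorem isPos_flip [Finite ι] [P.IsCrystallographic] [P.IsReduced] (b : P.Base) (i : ι) :
    b.flip.IsPos i ↔ b.IsPos i := by
  have key : ∀ (c : P.Base) (j : ι), j ∈ c.support → ∀ i, i ≠ j → i ≠ P.reflectionPerm j j →
      (c.IsPos (P.reflectionPerm j i) ↔ c.IsPos i) := by
    intro c j hj i h₁ h₂
    refine ⟨fun h => ?_, fun h => h.reflectionPerm hj h₁⟩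
    have := h.reflectionPerm hj (fun h₃ => h₂ (by
      rw [← P.reflectionPerm_self j i, h₃]))
    rwa [P.reflectionPerm_self] at this
  refine (b.induction_reflect (p := fun i => b.flip.IsPos i ↔ b.IsPos i) i
    (fun i h => ?_) (fun i hi => ?_) (fun i j h hj => ?_))
  · rw [isPos_reflectionPerm_self]
    exact (isPos_reflectionPerm_self b.flip i).trans (not_congr h)
  · exact iff_of_true (RootPairing.Base.isPos_of_mem_support (b := b.flip) hi)
      (RootPairing.Base.isPos_of_mem_support hi)
  · by_cases h₁ : i = j
    · subst h₁
      rw [isPos_reflectionPerm_self]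
      exact (isPos_reflectionPerm_self b.flip i).trans (not_congr h)
    by_cases h₂ : i = P.reflectionPerm j j
    · subst h₂
      rw [P.reflectionPerm_self]
      exact iff_of_true (RootPairing.Base.isPos_of_mem_support (b := b.flip) hj)
        (RootPairing.Base.isPos_of_mem_support hj)
    rw [key b j hj i h₁ h₂, ← h]
    by_cases hb : b.flip.IsPos i
    · exact iff_of_true (RootPairing.Base.IsPos.reflectionPerm (b := b.flip) hb hj h₁) hb
    · refine iff_of_false (fun hc => hb ?_) hb
      have := RootPairing.Base.IsPos.reflectionPerm (b := b.flip) hc hj (fun h₃ => h₂ (by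
        rw [← P.reflectionPerm_self j i]; exact congrArg _ h₃))
      have e : P.flip.reflectionPerm j (P.reflectionPerm j i) = i := P.reflectionPerm_self j i
      rwa [e] at this

end Negatives

/-! ### Alcove families and the walls of the fundamental alcove. -/

section Families

variable (P) in
/-- A family of integers indexed by the roots, antisymmetric in the appropriate sense, and
satisfying Shi's system of inequalities. -/
structure IsAlcoveFamily (K : ι → ℤ) : Prop where
  neg : ∀ i, K (P.reflectionPerm i i) = -1 - K i
  add : ∀ i j l, P.coroot l = P.coroot i + P.coroot j → K i + K j ≤ K l ∧ K l ≤ K i + K j + 1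

open Classical in
/-- The family of integers of the fundamental alcove. -/
noncomputable def baseFamily (b : P.Base) : ι → ℤ := fun i => if b.IsPos i then 0 else -1

theorem baseFamily_of_pos {b : P.Base} {i : ι} (h : b.IsPos i) : baseFamily b i = 0 := if_pos h

theorem baseFamily_of_not_pos {b : P.Base} {i : ι} (h : ¬ b.IsPos i) : baseFamily b i = -1 :=
  if_neg h

theorem baseFamily_neg (b : P.Base) (i : ι) :
    baseFamily b (P.reflectionPerm i i) = -1 - baseFamily b i := by
  by_cases h : b.IsPos i
  · rw [baseFamily_of_pos h, baseFamily_of_not_pos (by rwa [isPos_reflectionPerm_self, not_not]),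
      sub_zero]
  · rw [baseFamily_of_not_pos h, baseFamily_of_pos (by rwa [isPos_reflectionPerm_self])]
    simp

variable [P.IsCrystallographic]

theorem indexPerm_reflectionPerm_self (w : affineWeylGroup P) (i : ι) :
    indexPerm w (P.reflectionPerm i i) = P.reflectionPerm (indexPerm w i) (indexPerm w i) := by
  have h := isAffineSymmetry w
  refine coroot'_injective P (LinearMap.ext fun x => ?_)
  have h₁ := h.coroot_apply i x
  have h₂ := h.coroot_apply (P.reflectionPerm i i) x
  rw [coroot'_reflectionPerm_self, h.shift_eq, coroot'_reflectionPerm_self] at h₂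
  rw [h.shift_eq] at h₁
  rw [coroot'_reflectionPerm_self]
  linarith

theorem shift_reflectionPerm_self (w : affineWeylGroup P) (i : ι) :
    shift w (P.reflectionPerm i i) = -shift w i := by
  have h := isAffineSymmetry w
  have h₁ := h.shift_eq (P.reflectionPerm i i)
  rw [coroot'_reflectionPerm_self, ← h.shift_eq] at h₁
  exact_mod_cast h₁

theorem IsAlcoveFamily.act {K : ι → ℤ} (hK : IsAlcoveFamily P K) (w : affineWeylGroup P) :
    IsAlcoveFamily P (act w K) where
  neg i := by
    rw [ShiVariety.act, ShiVariety.act, indexPerm_reflectionPerm_self, shift_reflectionPerm_self,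
      hK.neg]
    ring
  add i j l h := by
    have hw := isAffineSymmetry w
    rw [coroot_eq_add_iff] at h
    have hs : shift w l = shift w i + shift w j := by
      have := h ((w : M ≃ᵃ[ℝ] M) 0)
      rw [← hw.shift_eq, ← hw.shift_eq, ← hw.shift_eq] at this
      exact_mod_cast this
    have hc : P.coroot (indexPerm w l) = P.coroot (indexPerm w i) + P.coroot (indexPerm w j) := by
      rw [coroot_eq_add_iff]
      intro x
      have := h ((w : M ≃ᵃ[ℝ] M) x)
      rw [hw.coroot_apply, hw.coroot_apply, hw.coroot_apply, hs] at this
      push_cast at this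
      linarith
    have := hK.add _ _ _ hc
    simp only [ShiVariety.act, hs]
    constructor <;> linarith

omit [P.IsCrystallographic] in
theorem refl_reflectionPerm_self (a : ι) (m : ℤ) :
    refl P (P.reflectionPerm a a) m = refl P a (-m) := by
  refine Subtype.ext (AffineEquiv.ext fun x => ?_)
  change affineReflection P _ _ x = affineReflection P _ _ x
  rw [affineReflection_apply, affineReflection_apply, coroot'_reflectionPerm_self,
    root_reflectionPerm_self]
  push_cast
  module

variable [Finite ι] [P.IsReduced]

theorem isPos_add_coroot (b : P.Base) {i j l : ι} (h : P.coroot l = P.coroot i + P.coroot j)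
    (hi : b.IsPos i) (hj : b.IsPos j) : b.IsPos l := by
  rw [← isPos_flip] at hi hj ⊢
  exact hi.add hj h

theorem isAlcoveFamily_baseFamily (b : P.Base) : IsAlcoveFamily P (baseFamily b) where
  neg := baseFamily_neg b
  add i j l h := by
    have h0 : ∀ i, b.IsPos i ∧ baseFamily b i = 0 ∨ ¬ b.IsPos i ∧ baseFamily b i = -1 := fun i => by
      by_cases hi : b.IsPos i
      · exact .inl ⟨hi, baseFamily_of_pos hi⟩
      · exact .inr ⟨hi, baseFamily_of_not_pos hi⟩
    have h1 : b.IsPos i → b.IsPos j → b.IsPos l := isPos_add_coroot b h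
    have h2 : ¬ b.IsPos i → ¬ b.IsPos j → ¬ b.IsPos l := by
      rw [← isPos_reflectionPerm_self, ← isPos_reflectionPerm_self, ← isPos_reflectionPerm_self]
      refine isPos_add_coroot b ?_
      simp only [coroot_reflectionPerm_self, h]
      abel
    have hi := h0 i
    have hj := h0 j
    have hl := h0 l
    clear h0
    grind

/-- The hyperplane `⟨x, a^∨⟩ = m` is a wall of the fundamental alcove. -/
structure IsWall (b : P.Base) (a : ι) (m : ℤ) : Prop where
  act_eq : ∀ i, i ≠ a → i ≠ P.reflectionPerm a a →
    act (refl P a m) (baseFamily b) i = baseFamily b i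
  eq_or : m = baseFamily b a ∨ m = baseFamily b a + 1

/-- The hyperplane `⟨x, a^∨⟩ = m` is adjacent to the fundamental alcove, and separates it from the
region defined by `K`. -/
def Separates (b : P.Base) (a : ι) (m : ℤ) (K : ι → ℤ) : Prop :=
  m = baseFamily b a + 1 ∧ baseFamily b a < K a ∨ m = baseFamily b a ∧ K a < baseFamily b a

omit [P.IsReduced] in
theorem IsAlcoveFamily.nonneg {b : P.Base} {K : ι → ℤ} (hK : IsAlcoveFamily P K)
    (h : ∀ i ∈ b.support, 0 ≤ K i) {i : ι} (hi : b.flip.IsPos i) : 0 ≤ K i := by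
  refine hi.induction_on_add (p := fun i => 0 ≤ K i) h fun i j k hk hi hj => ?_
  have := (hK.add i j k hk).1
  have := h j hj
  omega

omit [P.IsReduced] in
theorem exists_coroot_sub {i j : ι} (h : 0 < P.pairingIn ℤ i j) (hij : i ≠ j) :
    ∃ l, P.coroot i = P.coroot l + P.coroot j := by
  obtain ⟨l, hl⟩ := P.flip.root_sub_root_mem_of_pairingIn_pos
    (by rw [P.flip.zero_lt_pairingIn_iff']; exact h) hij
  exact ⟨l, by rw [show P.coroot l = P.coroot i - P.coroot j from hl]; abel⟩

/-- If K is negative at a simple root, the hyperplane of that root through 0 works. Otherwise K is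
nonnegative on positive roots and positive somewhere; a positive root with K > 0 of greatest coroot
height gives a wall at level 1. No irreducibility enters: this root only has to be maximal under
adding positive coroots. -/
theorem exists_wall (b : P.Base) {K : ι → ℤ} (hK : IsAlcoveFamily P K) (hne : K ≠ baseFamily b) :
    ∃ a m, IsWall b a m ∧ Separates b a m K := by
  by_cases hs : ∀ i ∈ b.support, 0 ≤ K i
  · have hpos : ∀ i, b.IsPos i → 0 ≤ K i := fun i hi => hK.nonneg hs ((isPos_flip b i).2 hi)
    have hex : ∃ i, b.IsPos i ∧ 0 < K i := by
      by_contra! hcon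
      refine hne (funext fun i => ?_)
      by_cases hi : b.IsPos i
      · rw [baseFamily_of_pos hi]
        exact le_antisymm (hcon i hi) (hpos i hi)
      · rw [baseFamily_of_not_pos hi]
        have hi' := (isPos_reflectionPerm_self b i).2 hi
        have h₁ := hcon _ hi'
        have h₂ := hpos _ hi'
        rw [hK.neg] at h₁ h₂
        omega
    obtain ⟨a, ⟨ha, haK⟩, hmax⟩ := Set.exists_max_image {i | b.IsPos i ∧ 0 < K i}
      b.flip.height (Set.toFinite _) hex
    -- Shi's lower inequality makes K positive at the sum l, whose greater height contradicts the
    -- choice of a.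
    have hadd : ∀ i l, P.coroot l = P.coroot i + P.coroot a → ¬ b.IsPos i := by
      intro i l hl hi
      have h₁ := hmax l ⟨isPos_add_coroot b hl hi ha, by
        have := (hK.add i a l hl).1
        have := hpos i hi
        omega⟩
      rw [b.flip.height_add (i := i) (j := a) hl] at h₁
      rw [← isPos_flip, RootPairing.Base.isPos_iff] at hi
      omega
    refine ⟨a, 1, ⟨fun i h₁ h₂ => ?_, .inr (by rw [baseFamily_of_pos ha, zero_add])⟩,
      .inl ⟨by rw [baseFamily_of_pos ha, zero_add], by rwa [baseFamily_of_pos ha]⟩⟩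
    have main : ∀ i, b.IsPos i → i ≠ a → act (refl P a 1) (baseFamily b) i = baseFamily b i := by
      intro i hi hia
      rw [act_refl, one_mul, baseFamily_of_pos hi]
      have hcor : P.coroot (P.reflectionPerm a i) =
          P.coroot i - P.pairingIn ℤ a i • P.coroot a := by
        rw [P.coroot_reflectionPerm, P.coreflection_apply_coroot, ← P.algebraMap_pairingIn ℤ]
        simp [Int.cast_smul_eq_zsmul]
      -- A negative pairing would make i^∨ + a^∨ a coroot, and a zero one fixes i. If positive, l^∨
      -- = i^∨ - a^∨ is a negative coroot. Pairing 1 means that s_a sends i to l, and the drop from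
      -- 0 to -1 is offset by the shift 1; pairing at least 2 would make -l^∨ + a^∨ a coroot, which
      -- `hadd` forbids.
      rcases lt_trichotomy (P.pairingIn ℤ a i) 0 with hp | hp | hp
      · exfalso
        have hne' : i ≠ P.reflectionPerm a a := fun h =>
          (isPos_reflectionPerm_self b a).1 (h ▸ hi) ha
        have hp' : 0 < P.pairingIn ℤ i (P.reflectionPerm a a) := by
          rw [P.zero_lt_pairingIn_iff', P.pairingIn_reflectionPerm_self_left]
          omega
        obtain ⟨l, hl⟩ := exists_coroot_sub hp' hne'
        rw [coroot_reflectionPerm_self, ← sub_eq_add_neg, eq_sub_iff_add_eq] at hl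
        exact hadd i l hl.symm hi
      · rw [hp, zero_smul, sub_zero] at hcor
        rw [P.coroot.injective hcor, baseFamily_of_pos hi, hp, add_zero]
      · obtain ⟨l, hl⟩ := exists_coroot_sub
          ((P.zero_lt_pairingIn_iff' (S := ℤ) (i := a) (j := i)).1 hp) hia
        have hl' := hadd l i hl
        have hnl := (isPos_reflectionPerm_self b l).2 hl'
        rcases (show P.pairingIn ℤ a i = 1 ∨ P.pairingIn ℤ a i = 2 ∨ 2 < P.pairingIn ℤ a i by
          omega) with hp | hp | hp
        · rw [hp, one_smul, hl, add_sub_cancel_right] at hcor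
          rw [P.coroot.injective hcor, baseFamily_of_not_pos hl', hp]
          norm_num
        · refine absurd hnl (hadd _ (P.reflectionPerm (P.reflectionPerm a i)
            (P.reflectionPerm a i)) ?_)
          rw [coroot_reflectionPerm_self, coroot_reflectionPerm_self, hcor, hp, hl]
          module
        · have hpl : 0 < P.pairingIn ℤ a l := by
            have := (coroot_eq_add_iff l a i).1 hl (P.root a)
            rw [coroot'_root, coroot'_root, coroot'_self] at this
            have : P.pairingIn ℤ a i = P.pairingIn ℤ a l + 2 := by exact_mod_cast this
            omega
          obtain ⟨l', hl''⟩ := exists_coroot_sub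
            ((P.zero_lt_pairingIn_iff' (S := ℤ) (i := a) (j := l)).1 hpl)
            (fun h => hl' (h ▸ ha))
          refine absurd hnl (hadd _ (P.reflectionPerm l' l') ?_)
          rw [coroot_reflectionPerm_self, coroot_reflectionPerm_self, hl'']
          abel
    by_cases hi : b.IsPos i
    · exact main i hi h₁
    · have := main (P.reflectionPerm i i) ((isPos_reflectionPerm_self b i).2 hi) (fun h => h₂ (by
        rw [← h, reflectionPerm_self_self]))
      rw [((isAlcoveFamily_baseFamily b).act _).neg, baseFamily_neg] at this
      omega
  · push Not at hs
    obtain ⟨a, ha, hKa⟩ := hs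
    have hpa := RootPairing.Base.isPos_of_mem_support ha
    refine ⟨a, 0, ⟨fun i h₁ h₂ => ?_, .inl (baseFamily_of_pos hpa).symm⟩,
      .inr ⟨(baseFamily_of_pos hpa).symm, by rwa [baseFamily_of_pos hpa]⟩⟩
    rw [act_refl, zero_mul, add_zero]
    by_cases hi : b.IsPos i
    · rw [baseFamily_of_pos hi, baseFamily_of_pos (hi.reflectionPerm ha h₁)]
    · rw [baseFamily_of_not_pos hi, baseFamily_of_not_pos fun h => hi ?_]
      have := h.reflectionPerm ha (fun h₃ => h₂ (by rw [← P.reflectionPerm_self a i, h₃]))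
      rwa [P.reflectionPerm_self] at this

end Families

end ShiVariety

namespace ShiVariety

variable {ι M N : Type*} [AddCommGroup M] [Module ℝ M] [AddCommGroup N] [Module ℝ N]
variable {P : RootPairing ι ℝ M N}

/-! ### Simple transitivity of the affine Weyl group on alcove families. -/

section Transitivity

variable [Fintype ι]

/-- Twice the number of hyperplanes separating the regions defined by `K` and `L`. -/
def familyDist (K L : ι → ℤ) : ℕ := ∑ i, (K i - L i).natAbs

variable [P.IsCrystallographic]

theorem familyDist_act (w : affineWeylGroup P) (K L : ι → ℤ) :
    familyDist (act w K) (act w L) = familyDist K L := by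
  simp only [familyDist, act, add_sub_add_right_eq_sub]
  exact Equiv.sum_comp (indexPerm w) fun i => (K i - L i).natAbs

variable [P.IsRootSystem]

theorem familyDist_act_refl (a : ι) (m : ℤ) (K L : ι → ℤ) :
    familyDist (act (refl P a m) K) L = familyDist K (act (refl P a m) L) := by
  rw [← familyDist_act (refl P a m) K, ← act_mul, refl_mul_self, act_one]

variable (b : P.Base)

omit [Fintype ι] [P.IsRootSystem] in
theorem act_refl_self (a : ι) (m : ℤ) :
    act (refl P a m) (baseFamily b) a = 2 * m - 1 - baseFamily b a := by
  rw [act_refl, baseFamily_neg, P.pairingIn_same]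
  ring

omit [Fintype ι] [P.IsRootSystem] in
theorem act_refl_neg_self (a : ι) (m : ℤ) :
    act (refl P a m) (baseFamily b) (P.reflectionPerm a a) = baseFamily b a - 2 * m := by
  rw [act_refl, P.reflectionPerm_self, P.pairingIn_reflectionPerm_self_right, P.pairingIn_same]
  ring

variable {b}

/-- Let the reflection act on the base family instead: only its entries at ±a change, each by one
unit towards K. -/
theorem familyDist_act_refl_lt {a : ι} {m : ℤ} (hw : IsWall b a m) {K : ι → ℤ}
    (hK : IsAlcoveFamily P K) (hs : Separates b a m K) :
    familyDist (act (refl P a m) K) (baseFamily b) < familyDist K (baseFamily b) := by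
  rw [familyDist_act_refl]
  have ha := act_refl_self b a m
  refine Finset.sum_lt_sum (fun i _ => ?_) ⟨a, Finset.mem_univ a, ?_⟩
  · by_cases h₁ : i = a
    · subst h₁
      rw [ha]
      unfold Separates at hs
      omega
    by_cases h₂ : i = P.reflectionPerm a a
    · subst h₂
      rw [act_refl_neg_self, hK.neg, baseFamily_neg]
      unfold Separates at hs
      omega
    rw [hw.act_eq i h₁ h₂]
  · rw [ha]
    unfold Separates at hs
    omega

variable (b) in
/-- The group generated by the reflections in the walls of the fundamental alcove. -/
def wallGroup : Subgroup (affineWeylGroup P) :=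
  Subgroup.closure {s | ∃ a m, IsWall b a m ∧ s = refl P a m}

omit [Fintype ι] [P.IsRootSystem] in
theorem refl_mem_wallGroup {a : ι} {m : ℤ} (hw : IsWall b a m) : refl P a m ∈ wallGroup b :=
  Subgroup.subset_closure ⟨a, m, hw, rfl⟩

variable [P.IsReduced]

theorem exists_mem_wallGroup {K : ι → ℤ} (hK : IsAlcoveFamily P K) :
    ∃ w ∈ wallGroup b, act w (baseFamily b) = K := by
  induction hn : familyDist K (baseFamily b) using Nat.strong_induction_on generalizing K with
  | _ n ih =>
    by_cases hne : K = baseFamily b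
    · exact ⟨1, one_mem _, by rw [act_one, hne]⟩
    obtain ⟨a, m, hw, hs⟩ := exists_wall b hK hne
    obtain ⟨w, hwm, hwK⟩ := ih _ (hn ▸ familyDist_act_refl_lt hw hK hs) (hK.act (refl P a m)) rfl
    exact ⟨refl P a m * w, mul_mem (refl_mem_wallGroup hw) hwm, by
      rw [act_mul, hwK, ← act_mul, refl_mul_self, act_one]⟩

/-- The descent step for `refl_mem`: if a wall separates A_e from its mirror image under a
reflection r, conjugating r by the wall reflection brings the mirror image closer, unless r is that
wall reflection. -/
theorem familyDist_conj_lt {a a' : ι} {m m' : ℤ} (hw : IsWall b a' m')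
    (hs : Separates b a' m' (act (refl P a m) (baseFamily b)))
    (hne : refl P a m ≠ refl P a' m') :
    familyDist (act (refl P a' m' * refl P a m * refl P a' m') (baseFamily b)) (baseFamily b) <
      familyDist (act (refl P a m) (baseFamily b)) (baseFamily b) := by
  rw [mul_assoc, act_mul, familyDist_act_refl, act_mul]
  set K₁ := act (refl P a' m') (baseFamily b) with hK₁
  set D : ι → ℤ := fun i => act (refl P a m) (baseFamily b) i - baseFamily b i with hD
  set e : ι → ℤ := fun i => K₁ i - baseFamily b i with he
  set σ := P.reflectionPerm a with hσ
  have hDσ : ∀ i, D (σ i) = - D i := fun i => by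
    simp only [hD, act_refl, hσ, P.reflectionPerm_self, P.pairingIn_reflectionPerm,
      P.pairingIn_reflectionPerm_self_left]
    ring
  have hDn : ∀ i, D (P.reflectionPerm i i) = - D i := fun i => by
    simp only [hD]
    rw [((isAlcoveFamily_baseFamily b).act _).neg, baseFamily_neg]
    ring
  have hea : e a' = 1 ∧ 0 < D a' ∨ e a' = -1 ∧ D a' < 0 := by
    have h := act_refl_self b a' m'
    have h₂ := hs
    simp only [he, hK₁, hD]
    unfold Separates at h₂
    omega
  have hen : e (P.reflectionPerm a' a') = - e a' := by
    simp only [he, hK₁]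
    rw [((isAlcoveFamily_baseFamily b).act _).neg, baseFamily_neg]
    ring
  have he0 : ∀ i, i ≠ a' → i ≠ P.reflectionPerm a' a' → e i = 0 := fun i h₁ h₂ => by
    simp only [he, hK₁, hw.act_eq i h₁ h₂, sub_self]
  have hei : ∀ i, e i = 0 ∨ e i = 1 ∧ 0 < D i ∨ e i = -1 ∧ D i < 0 := fun i => by
    by_cases h₁ : i = a'
    · subst h₁; exact .inr hea
    by_cases h₂ : i = P.reflectionPerm a' a'
    · subst h₂
      rw [hen, hDn]
      omega
    exact .inl (he0 i h₁ h₂)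
  -- As D (σ i) = -D i and e, where nonzero, is ±1 with the sign of D, both corrections move D i
  -- towards 0. They overshoot only when |D i| = 1 and both occur, which leaves the absolute value
  -- at 1.
  have hterm : ∀ i, act (refl P a m) K₁ i - K₁ i = D i + e (σ i) - e i := fun i => by
    simp only [hD, he, act_refl, hσ]
    ring
  refine Finset.sum_lt_sum (fun i _ => ?_) ⟨a', Finset.mem_univ a', ?_⟩
  · rw [hterm]
    change _ ≤ (D i).natAbs
    have h₁ := hei i
    have h₂ := hei (σ i)
    rw [hDσ] at h₂
    omega
  · rw [hterm]
    change _ < (D a').natAbs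
    have h₂ := hei (σ a')
    rw [hDσ] at h₂
    by_cases hz : e (σ a') = 0
    · omega
    by_cases h₃ : (D a').natAbs = 1
    -- The overshoot case at a': then σ sends a' to its opposite, so a and a' are proportional,
    -- hence equal or opposite by reducedness, and comparing levels makes the two reflections equal.
    · exfalso
      have h₄ : σ a' = P.reflectionPerm a' a' := by
        by_contra h₅
        have h₆ : σ a' ≠ a' := fun h => by
          have := hDσ a'
          rw [h] at this
          omega
        exact hz (he0 _ h₆ h₅)
      have hlin : ¬ LinearIndependent ℝ ![P.root a, P.root a'] := by
        rw [LinearIndependent.pair_iff]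
        intro hli
        have h₅ := congrArg P.root h₄
        rw [hσ, P.root_reflectionPerm, P.reflection_apply_root, root_reflectionPerm_self] at h₅
        have := (hli (-P.pairing a' a) 2 (by
          rw [← sub_eq_zero.2 h₅]
          module)).2
        norm_num at this
      have hDa : D a' = baseFamily b (σ a') + m * P.pairingIn ℤ a a' - baseFamily b a' := by
        simp only [hD, act_refl, hσ]
      rw [h₄, baseFamily_neg] at hDa
      have hea' : e a' = 2 * m' - 1 - 2 * baseFamily b a' := by
        simp only [he, hK₁, act_refl_self]
        ring
      rcases eq_or_eq_reflectionPerm_self hlin with h | h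
      · subst h
        rw [P.pairingIn_same] at hDa
        exact hne (congrArg _ (by omega))
      · rw [h, P.pairingIn_reflectionPerm_self_left, P.pairingIn_same] at hDa
        refine hne ?_
        rw [h, refl_reflectionPerm_self]
        exact congrArg _ (by omega)
    · omega

/-- Strong induction on the distance from A_e to its mirror image: conjugation by a separating wall
reflection decreases it and does not affect membership in the wall group. -/
theorem refl_mem (a : ι) (m : ℤ) : refl P a m ∈ wallGroup b := by
  induction hn : familyDist (act (refl P a m) (baseFamily b)) (baseFamily b)
    using Nat.strong_induction_on generalizing a m with
  | _ n ih =>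
    have hne : act (refl P a m) (baseFamily b) ≠ baseFamily b := fun h => by
      have h₁ := congrFun h a
      rw [act_refl_self] at h₁
      omega
    obtain ⟨a', m', hw, hs⟩ := exists_wall b ((isAlcoveFamily_baseFamily b).act _) hne
    have hm := refl_mem_wallGroup hw
    by_cases heq : refl P a m = refl P a' m'
    · rwa [heq]
    have hlt := familyDist_conj_lt hw hs heq
    have hinv : (refl P a' m')⁻¹ = refl P a' m' := inv_eq_of_mul_eq_one_left (refl_mul_self a' m')
    -- The index is reflected beforehand so that the involution turns the middle factor back into
    -- `refl P a m`.
    have hc := conj_refl (refl P a' m') (P.reflectionPerm a' a) m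
    rw [indexPerm_refl, P.reflectionPerm_self, hinv] at hc
    rw [hc] at hlt
    have h₁ := ih _ (hn ▸ hlt) _ _ rfl
    rw [← hc] at h₁
    exact (Subgroup.mul_mem_cancel_left _ hm).1 ((Subgroup.mul_mem_cancel_right _ hm).1 h₁)

variable (b) in
theorem wallGroup_eq_top : wallGroup b = ⊤ := by
  rw [eq_top_iff]
  rintro ⟨w, hw⟩ -
  induction hw using Subgroup.closure_induction with
  | mem _ h =>
    obtain ⟨a, m, rfl⟩ := h
    exact refl_mem a m
  | one => exact one_mem _
  | mul _ _ _ _ h₁ h₂ => exact mul_mem h₁ h₂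
  | inv _ _ h => exact inv_mem h

variable (b) in
/-- A list of reflections in the walls of the fundamental alcove. -/
def IsWallList (l : List (affineWeylGroup P)) : Prop :=
  ∀ s ∈ l, ∃ a m, IsWall b a m ∧ s = refl P a m

-- The exchange condition. Follow the alcoves of the successive prefixes: at the letter where the
-- hyperplane is first crossed, the conjugate of that letter by the prefix is the given reflection,
-- so the letter can be deleted.
omit [Fintype ι] [P.IsReduced] in
theorem IsWallList.exchange {a : ι} {m : ℤ} (l : List (affineWeylGroup P)) (hl : IsWallList b l)
    (hs : Separates b a m (act l.prod (baseFamily b))) :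
    ∃ l', IsWallList b l' ∧ l'.length + 1 = l.length ∧ l'.prod = refl P a m * l.prod := by
  induction l using List.reverseRecOn with
  | nil =>
    rw [List.prod_nil, act_one] at hs
    unfold Separates at hs
    omega
  | append_singleton l t ih =>
    have hl₁ : IsWallList b l := fun s h => hl s (by simp [h])
    by_cases hs₁ : Separates b a m (act l.prod (baseFamily b))
    · obtain ⟨l', h₁, h₂, h₃⟩ := ih hl₁ hs₁
      refine ⟨l' ++ [t], ?_, by simp [← h₂], by simp [h₃, mul_assoc]⟩
      intro s h
      rcases List.mem_append.1 h with h | h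
      · exact h₁ s h
      · exact hl s (by simp [List.mem_singleton.1 h])
    · obtain ⟨a', m', hw', rfl⟩ := hl t (by simp)
      refine ⟨l, hl₁, by simp, ?_⟩
      rw [List.prod_append, List.prod_singleton] at hs ⊢
      set g := l.prod
      -- The last letter creates the separation. It changes the base family only at ±a', so
      -- `indexPerm g a` must be one of these, and `conj_refl` identifies the conjugate.
      suffices h : g * refl P a' m' * g⁻¹ = refl P a m by
        rw [← h]
        simp only [mul_assoc, inv_mul_cancel_left, refl_mul_self, mul_one]
      rw [act_mul] at hs
      simp only [Separates, act] at hs hs₁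
      have hself := act_refl_self b a' m'
      have hneg := act_refl_neg_self b a' m'
      simp only [act] at hself hneg
      have hor := hw'.eq_or
      by_cases h₁ : indexPerm g a = a'
      · subst h₁
        rw [conj_refl]
        refine congrArg _ ?_
        omega
      by_cases h₂ : indexPerm g a = P.reflectionPerm a' a'
      · have h₃ : refl P a' m' = refl P (indexPerm g a) (-m') := by
          rw [h₂, refl_reflectionPerm_self, neg_neg]
        rw [h₃, conj_refl]
        refine congrArg _ ?_
        rw [h₂, baseFamily_neg] at hs₁
        rw [h₂] at hs
        omega
      · exfalso
        have h₃ := hw'.act_eq _ h₁ h₂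
        simp only [act] at h₃
        rw [h₃] at hs
        exact hs₁ hs

-- If s·u fixes the base family, then u carries it to its mirror image under s, which the wall of s
-- separates from it; by exchange s·u is a shorter word, and the length descends.
omit [Fintype ι] [P.IsReduced] in
theorem IsWallList.prod_eq_one (l : List (affineWeylGroup P)) (hl : IsWallList b l)
    (h : act l.prod (baseFamily b) = baseFamily b) : l.prod = 1 := by
  induction hn : l.length using Nat.strong_induction_on generalizing l with
  | _ n ih =>
    cases l with
    | nil => rfl
    | cons s l =>
      obtain ⟨a, m, hw, rfl⟩ := hl s (by simp)
      rw [List.prod_cons] at h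
      have h₁ : act l.prod (baseFamily b) = act (refl P a m) (baseFamily b) := by
        conv_rhs => rw [← h]
        rw [← act_mul, ← mul_assoc, refl_mul_self, one_mul]
      have hor := hw.eq_or
      obtain ⟨l', h₂, h₃, h₄⟩ := exchange (b := b) (a := a) (m := m) l (fun s h => hl s (by simp [h])) (by
        rw [h₁]
        unfold Separates
        rw [act_refl_self]
        omega)
      rw [List.prod_cons, ← h₄]
      refine ih l'.length (by rw [List.length_cons] at hn; omega) l' h₂ ?_ rfl
      rw [h₄, h]

theorem eq_one_of_act_eq {w : affineWeylGroup P} (h : act w (baseFamily b) = baseFamily b) :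
    w = 1 := by
  have hw : w ∈ wallGroup b := wallGroup_eq_top b ▸ Subgroup.mem_top w
  rw [wallGroup, ← Subgroup.mem_toSubmonoid, Subgroup.closure_toSubmonoid] at hw
  obtain ⟨l, hl, rfl⟩ := Submonoid.exists_list_of_mem_closure hw
  refine IsWallList.prod_eq_one (b := b) l (fun s hs => ?_) h
  rcases hl s hs with h | ⟨a, m, hw, h⟩
  · exact h
  · refine ⟨a, m, hw, ?_⟩
    rw [← inv_inv s, h]
    exact inv_eq_of_mul_eq_one_left (refl_mul_self a m)

variable (b) in
theorem act_baseFamily_injective :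
    Function.Injective fun w : affineWeylGroup P => act w (baseFamily b) := by
  intro v w h
  have h₁ : act (w⁻¹ * v) (baseFamily b) = baseFamily b := by
    rw [act_mul, show act v (baseFamily b) = act w (baseFamily b) from h, act_inv_act]
  exact (inv_mul_eq_one.1 (eq_one_of_act_eq h₁)).symm

end Transitivity

end ShiVariety

namespace ShiVariety

variable {ι M N : Type*} [AddCommGroup M] [Module ℝ M] [AddCommGroup N] [Module ℝ N]
variable {P : RootPairing ι ℝ M N}

/-! ### Coefficients and heights of coroots, and coordinates on the ambient space. -/

section Coordinates

theorem corootCoeff_add (b : P.Base) {i j l : ι} (h : P.coroot l = P.coroot i + P.coroot j)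
    (s : b.support) : corootCoeff b l s = corootCoeff b i s + corootCoeff b j s :=
  rootCoeff_add b.flip i j l h s

theorem corootCoeff_simple (b : P.Base) [DecidableEq b.support] (i j : b.support) :
    corootCoeff b i j = if i = j then 1 else 0 :=
  (@rootCoeff_simple _ _ _ _ _ _ _ P.flip b.flip (Classical.decEq _) i j).trans (by congr)

theorem rootCoeff_neg (b : P.Base) (i : ι) (s : b.support) :
    rootCoeff b (P.reflectionPerm i i) s = -rootCoeff b i s := by
  have e : P.rootSpanMem ℤ (P.reflectionPerm i i) = -P.rootSpanMem ℤ i :=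
    Subtype.ext (root_reflectionPerm_self i)
  rw [rootCoeff, e, map_neg, Finsupp.neg_apply, rootCoeff]

theorem corootCoeff_neg (b : P.Base) (i : ι) (s : b.support) :
    corootCoeff b (P.reflectionPerm i i) s = -corootCoeff b i s :=
  rootCoeff_neg b.flip i s

theorem coroot'_eq_sum (b : P.Base) (i : ι) (x : M) :
    P.coroot' i x = ∑ s : b.support, (corootCoeff b i s : ℝ) * P.coroot' s x := by
  have h := congrArg (fun n => P.toLinearMap.flip n x) (coroot_eq_sum b i)
  simp only [map_sum, map_zsmul, LinearMap.sum_apply, LinearMap.smul_apply, zsmul_eq_mul] at h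
  exact h

theorem corootCoeff_nonneg [Finite ι] [P.IsCrystallographic] {b : P.Base} {i : ι}
    (hi : b.flip.IsPos i) (s : b.support) : 0 ≤ corootCoeff b i s := by
  classical
  refine hi.induction_on_add (p := fun i => 0 ≤ corootCoeff b i s) (fun i hi => ?_)
    fun i j k hk h hj => ?_
  · rw [corootCoeff_simple b ⟨i, hi⟩]
    split_ifs <;> norm_num
  · rw [corootCoeff_add b hk, corootCoeff_simple b ⟨j, hj⟩]
    split_ifs <;> omega

theorem corootHeight_add (b : P.Base) {i j l : ι} (h : P.coroot l = P.coroot i + P.coroot j) :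
    corootHeight b l = corootHeight b i + corootHeight b j := by
  simp only [corootHeight, corootCoeff_add b h, Finset.sum_add_distrib]

theorem corootHeight_simple (b : P.Base) {i : ι} (hi : i ∈ b.support) : corootHeight b i = 1 := by
  classical
  simp only [corootHeight, corootCoeff_simple b ⟨i, hi⟩]
  simp

theorem corootHeight_pos [Finite ι] [P.IsCrystallographic] {b : P.Base} {i : ι}
    (hi : b.flip.IsPos i) : 0 < corootHeight b i := by
  refine hi.induction_on_add (p := fun i => 0 < corootHeight b i) (fun i hi => ?_)
    fun i j k hk h hj => ?_
  · rw [corootHeight_simple b hi]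
    norm_num
  · rw [corootHeight_add b hk, corootHeight_simple b hj]
    omega

/-- The linear coordinates `x ↦ (⟨x, α_i^∨⟩)_i`. -/
noncomputable def coords [P.IsRootSystem] (b : P.Base) : M ≃ₗ[ℝ] (b.support → ℝ) :=
  P.toPerfPair.trans (b.toCoweightBasis.constr ℝ).symm

theorem coords_apply [P.IsRootSystem] (b : P.Base) (x : M) (s : b.support) :
    coords b x s = P.coroot' s x := by
  change (b.toCoweightBasis.constr ℝ).symm (P.toPerfPair x) s = _
  rw [Module.Basis.constr_symm_apply]
  simp

end Coordinates

/-! ### Alcoves as regions cut out by families of integers. -/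

section Regions

variable (P) in
/-- The region of `M` defined by a family of integers indexed by the roots. -/
def region (K : ι → ℤ) : Set M := {x | ∀ i, x ∈ strip P i (K i)}

theorem strip_reflectionPerm_self (i : ι) (k : ℤ) :
    strip P (P.reflectionPerm i i) (-1 - k) = strip P i k := by
  ext x
  simp only [strip, Set.mem_ofPred_eq, coroot'_reflectionPerm_self]
  push_cast
  constructor <;> rintro ⟨h₁, h₂⟩ <;> constructor <;> linarith

theorem region_eq_iInter (b : P.Base) {K : ι → ℤ}
    (hK : ∀ i, K (P.reflectionPerm i i) = -1 - K i) :
    region P K = ⋂ α : PosRoot b, strip P α (K α) := by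
  ext x
  rw [Set.mem_iInter]
  refine ⟨fun h α => h α, fun h i => ?_⟩
  by_cases hi : b.IsPos i
  · exact h ⟨i, hi⟩
  · have := h ⟨_, (isPos_reflectionPerm_self b i).2 hi⟩
    rwa [hK, strip_reflectionPerm_self] at this

theorem fundamentalAlcove_eq (b : P.Base) : fundamentalAlcove b = region P (baseFamily b) := by
  rw [region_eq_iInter b (baseFamily_neg b)]
  exact Set.iInter_congr fun α => by rw [baseFamily_of_pos α.2]

theorem floor_of_mem_strip {i : ι} {k : ℤ} {x : M} (h : x ∈ strip P i k) :
    ⌊P.coroot' i x⌋ = k :=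
  Int.floor_eq_iff.2 ⟨h.1.le, h.2⟩

variable [P.IsCrystallographic]

theorem image_region (w : affineWeylGroup P) (K : ι → ℤ) :
    (w : M ≃ᵃ[ℝ] M) '' region P K = region P (act w K) := by
  have hw := isAffineSymmetry w
  have key : ∀ x, (w : M ≃ᵃ[ℝ] M) x ∈ region P (act w K) ↔ x ∈ region P K := by
    intro x
    rw [region, region, Set.mem_ofPred_eq, Set.mem_ofPred_eq,
      ← (indexPerm w).forall_congr_right (q := fun i => x ∈ strip P i (K i))]
    refine forall_congr' fun i => ?_
    simp only [strip, Set.mem_ofPred_eq, hw.coroot_apply, act]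
    push_cast
    constructor <;> rintro ⟨h₁, h₂⟩ <;> constructor <;> linarith
  ext y
  constructor
  · rintro ⟨x, hx, rfl⟩
    exact (key x).2 hx
  · intro hy
    refine ⟨(w : M ≃ᵃ[ℝ] M).symm y, (key _).1 ?_, (w : M ≃ᵃ[ℝ] M).apply_symm_apply y⟩
    rwa [(w : M ≃ᵃ[ℝ] M).apply_symm_apply]

theorem alcove_eq_region (b : P.Base) (w : affineWeylGroup P) :
    alcove b w = region P (act w (baseFamily b)) := by
  rw [alcove, fundamentalAlcove_eq, image_region]

variable [Finite ι] [P.IsReduced] [P.IsRootSystem] (b : P.Base)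

theorem fundamentalAlcove_nonempty : (fundamentalAlcove b).Nonempty := by
  obtain ⟨H, hH⟩ := (Set.finite_range (corootHeight b)).bddAbove
  -- A point with all simple coordinates c takes the value height · c at a coroot, so c must lie
  -- below the reciprocal of every height. The `max` keeps the denominator positive without knowing
  -- the sign of H.
  set c : ℝ := 1 / (max H 0 + 1 : ℤ) with hc
  have hH0 : (0 : ℝ) < (max H 0 + 1 : ℤ) := by
    have : 0 < max H 0 + 1 := by omega
    exact_mod_cast this
  have hc0 : 0 < c := by positivity
  refine ⟨(coords b).symm fun _ => c, Set.mem_iInter.2 fun α => ?_⟩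
  have hα : P.coroot' α ((coords b).symm fun _ => c) = corootHeight b α * c := by
    rw [coroot'_eq_sum b]
    simp only [← coords_apply, LinearEquiv.apply_symm_apply, ← Finset.sum_mul, corootHeight]
    push_cast
    rfl
  have hpos : (0 : ℝ) < corootHeight b α := by
    exact_mod_cast corootHeight_pos ((isPos_flip b α).2 α.2)
  have hlt : (corootHeight b α : ℝ) < (max H 0 + 1 : ℤ) := by
    have : corootHeight b α ≤ H := hH ⟨_, rfl⟩
    have : corootHeight b α < max H 0 + 1 := by omega
    exact_mod_cast this
  have hmul : (corootHeight b α : ℝ) * c < 1 := by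
    rw [hc, mul_one_div, div_lt_one hH0]
    exact hlt
  rw [strip, Set.mem_ofPred_eq, hα]
  push_cast
  exact ⟨by positivity, by rwa [zero_add]⟩

theorem region_nonempty {K : ι → ℤ} (hK : IsAlcoveFamily P K) (b : P.Base) :
    (region P K).Nonempty := by
  have := Fintype.ofFinite ι
  obtain ⟨w, -, rfl⟩ := exists_mem_wallGroup (b := b) hK
  rw [← alcove_eq_region]
  exact (fundamentalAlcove_nonempty b).image _

/-- Uniqueness depends on the alcove being nonempty: the floors of the coroot values at any of its
points recover k. -/
theorem isShiVector_iff (w : affineWeylGroup P) (k : PosRoot b → ℤ) :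
    IsShiVector b w k ↔ k = fun α : PosRoot b => act w (baseFamily b) α := by
  have hK := (isAlcoveFamily_baseFamily b).act w
  rw [IsShiVector, alcove_eq_region]
  constructor
  · intro h
    obtain ⟨x, hx⟩ := region_nonempty hK b
    funext α
    rw [← floor_of_mem_strip (hx α)]
    rw [h] at hx
    exact (floor_of_mem_strip (Set.mem_iInter.1 hx α)).symm
  · rintro rfl
    exact region_eq_iInter b hK.neg

theorem shiCoeff_eq (w : affineWeylGroup P) :
    shiCoeff b w = fun α : PosRoot b => act w (baseFamily b) α :=
  (isShiVector_iff b w _).1 (Classical.epsilon_spec ⟨_, (isShiVector_iff b w _).2 rfl⟩)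

end Regions

/-! ### Shi's system on the positive roots and on all roots. -/

section ShiSystem

variable (b : P.Base)

theorem IsAlcoveFamily.satisfiesShiSystem {K : ι → ℤ} (hK : IsAlcoveFamily P K) :
    SatisfiesShiSystem b fun α => K α :=
  fun α β γ h => hK.add α β γ h

open Classical in
/-- The extension of a family of integers from the positive roots to all roots. -/
noncomputable def extend (k : PosRoot b → ℤ) : ι → ℤ := fun i =>
  if h : b.IsPos i then k ⟨i, h⟩ else
    -1 - k ⟨P.reflectionPerm i i, (isPos_reflectionPerm_self b i).2 h⟩

variable {b}

theorem extend_of_pos (k : PosRoot b → ℤ) (α : PosRoot b) : extend b k α = k α := dif_pos α.2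

theorem extend_neg (k : PosRoot b → ℤ) (i : ι) :
    extend b k (P.reflectionPerm i i) = -1 - extend b k i := by
  by_cases h : b.IsPos i
  · have h' : ¬ b.IsPos (P.reflectionPerm i i) := by rwa [isPos_reflectionPerm_self, not_not]
    rw [extend, extend, dif_neg h', dif_pos h]
    simp only [reflectionPerm_self_self]
  · have h' := (isPos_reflectionPerm_self b i).2 h
    rw [extend, extend, dif_neg h, dif_pos h']
    ring

/-- A relation among coroots of mixed sign becomes one among positive coroots after moving terms
across; the rule K ↦ -1 - K makes the two inequalities trade places. -/
theorem SatisfiesShiSystem.extend [Finite ι] [P.IsCrystallographic] [P.IsReduced]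
    {k : PosRoot b → ℤ} (hk : SatisfiesShiSystem b k) : IsAlcoveFamily P (extend b k) where
  neg := extend_neg k
  add := by
    have key : ∀ i j l, b.IsPos i → b.IsPos j → b.IsPos l → P.coroot l = P.coroot i + P.coroot j →
        ShiVariety.extend b k i + ShiVariety.extend b k j ≤ ShiVariety.extend b k l ∧
          ShiVariety.extend b k l ≤ ShiVariety.extend b k i + ShiVariety.extend b k j + 1 := by
      intro i j l hi hj hl h
      rw [extend_of_pos k ⟨i, hi⟩, extend_of_pos k ⟨j, hj⟩, extend_of_pos k ⟨l, hl⟩]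
      exact hk _ _ _ h
    intro i j l h
    have hneg : ∀ i, ¬ b.IsPos i → b.IsPos (P.reflectionPerm i i) := fun i =>
      (isPos_reflectionPerm_self b i).2
    have ei := extend_neg k i
    have ej := extend_neg k j
    have el := extend_neg k l
    have ci := coroot_reflectionPerm_self (P := P) i
    have cj := coroot_reflectionPerm_self (P := P) j
    have cl := coroot_reflectionPerm_self (P := P) l
    by_cases hi : b.IsPos i <;> by_cases hj : b.IsPos j <;> by_cases hl : b.IsPos l
    · exact key i j l hi hj hl h
    · exact absurd (isPos_add_coroot b h hi hj) hl
    · have := key l _ i hl (hneg j hj) hi (by rw [cj, h]; abel)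
      omega
    · have := key i _ _ hi (hneg l hl) (hneg j hj) (by rw [cj, cl, h]; abel)
      omega
    · have := key l _ j hl (hneg i hi) hj (by rw [ci, h]; abel)
      omega
    · have := key j _ _ hj (hneg l hl) (hneg i hi) (by rw [ci, cl, h]; abel)
      omega
    · refine absurd hl ((isPos_reflectionPerm_self b l).1 ?_)
      exact isPos_add_coroot b (by rw [ci, cj, cl, h]; abel) (hneg i hi) (hneg j hj)
    · have := key _ _ _ (hneg i hi) (hneg j hj) (hneg l hl) (by rw [ci, cj, cl, h]; abel)
      omega

theorem IsAdmissible.simple {v : PosRoot b → ℤ} (hv : IsAdmissible b v) (s : b.support) :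
    v (simple b s) = 0 := by
  have h := hv (ShiVariety.simple b s)
  have e : corootHeight b (ShiVariety.simple b s) = 1 := corootHeight_simple b s.2
  rw [interval, Finset.mem_Icc, e] at h
  exact le_antisymm (by simpa using h.2) h.1

/-- Build the coroot by adding simple coroots: each addition raises the height by 1 and, as v
vanishes at simple roots, raises v by 0 or 1. -/
theorem SatisfiesShiSystem.isAdmissible [Finite ι] [P.IsCrystallographic] [P.IsReduced]
    {v : PosRoot b → ℤ} (hv : SatisfiesShiSystem b v) (h0 : ∀ s, v (simple b s) = 0) :
    IsAdmissible b v := by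
  have key : ∀ i, b.flip.IsPos i → ∀ hi : b.IsPos i, 0 ≤ v ⟨i, hi⟩ ∧
      v ⟨i, hi⟩ ≤ corootHeight b i - 1 := by
    intro i hi
    refine hi.induction_on_add (p := fun i => ∀ hi : b.IsPos i, 0 ≤ v ⟨i, hi⟩ ∧
      v ⟨i, hi⟩ ≤ corootHeight b i - 1) (fun i hi hpos => ?_) fun i j k hk h hj hpos => ?_
    · rw [corootHeight_simple b hi]
      have : v ⟨i, hpos⟩ = 0 := h0 ⟨i, hi⟩
      omega
    · by_cases hi : b.IsPos i
      · have h₁ := h hi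
        have h₂ := h0 ⟨j, hj⟩
        have h₃ := hv ⟨i, hi⟩ (ShiVariety.simple b ⟨j, hj⟩) ⟨k, hpos⟩ hk
        rw [corootHeight_add b hk, corootHeight_simple b hj]
        omega
      · exfalso
        have h₁ := b.flip.height_add (i := i) (j := j) (k := k) hk
        rw [RootPairing.Base.height_one_of_mem_support (b := b.flip) hj] at h₁
        rw [← isPos_flip, RootPairing.Base.isPos_iff'] at hi
        rw [← isPos_flip, RootPairing.Base.isPos_iff] at hpos
        omega
  intro α
  rw [interval, Finset.mem_Icc]
  exact key α ((isPos_flip b α).2 α.2) α.2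

end ShiSystem

/-! ### The affine pieces X[λ] and the integral points of their union. -/

section Varieties

variable {b : P.Base}

theorem aeval_shiPoly (x : PosRoot b → ℝ) (α : PosRoot b) (l : ℤ) :
    MvPolynomial.aeval x (shiPoly b α l) =
      ∑ s : b.support, (corootCoeff b α s : ℝ) * x (simple b s) + l - x α := by
  simp [shiPoly, linPoly]

theorem mem_varXAt {v : PosRoot b → ℤ} {x : PosRoot b → ℝ} : x ∈ varXAt b v ↔
    ∀ α : PosRoot b, x α = ∑ s : b.support, (corootCoeff b α s : ℝ) * x (simple b s) + v α := by
  have h : x ∈ varXAt b v ↔ ∀ α, MvPolynomial.aeval x (shiPoly b α (v α)) = 0 := by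
    constructor
    · exact fun h α => h _ (Ideal.subset_span ⟨α, rfl⟩)
    · intro h p hp
      have hle : idealJAt b v ≤ RingHom.ker (MvPolynomial.aeval (R := ℤ) x) := by
        rw [idealJAt, Ideal.span_le]
        rintro _ ⟨α, rfl⟩
        exact RingHom.mem_ker.2 (h α)
      exact RingHom.mem_ker.1 (hle hp)
  rw [h]
  refine forall_congr' fun α => ?_
  rw [aeval_shiPoly, sub_eq_zero, eq_comm]

theorem mem_varX_of_mem_varXAt {v : PosRoot b → ℤ} (hv : IsAdmissible b v) {x : PosRoot b → ℝ}
    (hx : x ∈ varXAt b v) : x ∈ varX b := by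
  intro p hp
  have hle : idealJ b ≤ RingHom.ker (MvPolynomial.aeval (R := ℤ) x) := by
    refine iSup_le fun α => ?_
    rw [Ideal.span_le, Set.singleton_subset_iff]
    refine RingHom.mem_ker.2 ?_
    rw [map_prod]
    refine Finset.prod_eq_zero (hv α) ?_
    rw [aeval_shiPoly, mem_varXAt.1 hx α, sub_self]
  exact RingHom.mem_ker.1 (hle hp)

theorem shiVariety_subset_varX (b : P.Base) : shiVariety b ⊆ varX b := by
  intro x hx
  obtain ⟨v, hv, hx⟩ := Set.mem_iUnion₂.1 hx
  exact mem_varX_of_mem_varXAt hv.1 hx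

theorem eq_of_mem_varXAt {v v' : PosRoot b → ℤ} {x : PosRoot b → ℝ} (h : x ∈ varXAt b v)
    (h' : x ∈ varXAt b v') : v = v' := by
  funext α
  have := (mem_varXAt.1 h α).symm.trans (mem_varXAt.1 h' α)
  rw [add_right_inj] at this
  exact_mod_cast this

theorem finite_isAdmitted [Finite ι] (b : P.Base) : {v | IsAdmitted b v}.Finite := by
  refine (Set.Finite.pi fun α => (interval b α).finite_toSet).subset fun v hv => ?_
  exact Set.mem_univ_pi.2 hv.1

theorem isClosed_iff_zariski {σ : Type*} {Y : Set (σ → ℝ)} :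
    IsClosed[zariskiTopology σ] Y ↔ ∃ I : Ideal (MvPolynomial σ ℝ), Y = zeroSet I := by
  rw [← @isOpen_compl_iff _ _ (zariskiTopology σ)]
  change Yᶜᶜ ∈ Set.range zeroSet ↔ _
  rw [compl_compl]
  exact exists_congr fun I => eq_comm

/-- Needed because the varieties come from ideals over ℤ while the Zariski topology uses ideals over
ℝ. -/
theorem zeroSet_map {σ : Type*} (I : Ideal (MvPolynomial σ ℤ)) :
    zeroSet (I.map (MvPolynomial.map (Int.castRingHom ℝ))) = zeroSet I := by
  ext x
  have h : ∀ p : MvPolynomial σ ℤ, MvPolynomial.aeval x (MvPolynomial.map (Int.castRingHom ℝ) p) =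
      MvPolynomial.aeval x p := fun p => by
    rw [MvPolynomial.aeval_def, MvPolynomial.eval₂_map, MvPolynomial.aeval_def]
    congr 1
  constructor
  · intro hx p hp
    rw [← h]
    exact hx _ (Ideal.mem_map_of_mem _ hp)
  · intro hx p hp
    have hle : I.map (MvPolynomial.map (Int.castRingHom ℝ)) ≤
        RingHom.ker (MvPolynomial.aeval (R := ℝ) x) := by
      rw [Ideal.map_le_iff_le_comap]
      intro q hq
      rw [Ideal.mem_comap, RingHom.mem_ker]
      exact (h q).trans (hx q hq)
    exact RingHom.mem_ker.1 (hle hp)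

theorem isClosed_varXAt (v : PosRoot b → ℤ) : IsClosed[zariskiTopology _] (varXAt b v) :=
  isClosed_iff_zariski.2 ⟨_, (zeroSet_map _).symm⟩

theorem isClosed_shiVariety [Finite ι] (b : P.Base) :
    IsClosed[zariskiTopology _] (shiVariety b) := by
  let _ := zariskiTopology (PosRoot b)
  exact (finite_isAdmitted b).isClosed_biUnion fun v _ => isClosed_varXAt v

variable [Finite ι] [P.IsCrystallographic] [P.IsReduced]

/-- Shi's system is unchanged by adding a vector that is linear in the coroot. Subtracting the
linear part determined by the simple coordinates gives a solution vanishing at the simple roots,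
which is admitted. -/
theorem mem_integralPoints_shiVariety {x : PosRoot b → ℝ} :
    x ∈ integralPoints (shiVariety b) ↔
      ∃ k : PosRoot b → ℤ, SatisfiesShiSystem b k ∧ ∀ α, x α = k α := by
  classical
  constructor
  · rintro ⟨hx, hint⟩
    choose k hk using hint
    refine ⟨k, fun α β γ h => ?_, hk⟩
    obtain ⟨v, hv, hx⟩ := Set.mem_iUnion₂.1 hx
    have hkv : ∀ α : PosRoot b,
        k α = ∑ s : b.support, corootCoeff b α s * k (simple b s) + v α := fun α => by
      have := mem_varXAt.1 hx α
      simp only [hk] at this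
      exact_mod_cast this
    have hs := hv.2 α β γ h
    simp only [hkv α, hkv β, hkv γ, corootCoeff_add b h, add_mul, Finset.sum_add_distrib]
    constructor <;> linarith
  · rintro ⟨k, hk, hx⟩
    refine ⟨?_, fun α => ⟨k α, hx α⟩⟩
    set v : PosRoot b → ℤ :=
      fun α => k α - ∑ s : b.support, corootCoeff b α s * k (simple b s) with hv
    have hshi : SatisfiesShiSystem b v := fun α β γ h => by
      have := hk α β γ h
      simp only [hv, corootCoeff_add b h, add_mul, Finset.sum_add_distrib]
      constructor <;> linarith
    refine Set.mem_iUnion₂.2 ⟨v, ⟨hshi.isAdmissible fun s => ?_, hshi⟩, mem_varXAt.2 fun α => ?_⟩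
    · simp only [hv]
      have : ∀ t : b.support, corootCoeff b (simple b s) t = if s = t then 1 else 0 :=
        corootCoeff_simple b s
      simp [this]
    · simp only [hx, hv]
      push_cast
      ring

theorem bijOn_shiMap [P.IsRootSystem] (b : P.Base) :
    Set.BijOn (shiMap b) Set.univ (integralPoints (shiVariety b)) := by
  have := Fintype.ofFinite ι
  have hmap : ∀ w α, shiMap b w α = act w (baseFamily b) α := fun w α => by
    rw [shiMap, shiCoeff_eq]
  refine ⟨fun w _ => mem_integralPoints_shiVariety.2
    ⟨_, ((isAlcoveFamily_baseFamily b).act w).satisfiesShiSystem b, hmap w⟩, fun v _ w _ h => ?_,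
    fun x hx => ?_⟩
  · refine act_baseFamily_injective b (funext fun i => ?_)
    have key : ∀ i, b.IsPos i → act v (baseFamily b) i = act w (baseFamily b) i := fun i hi => by
      have := congrFun h ⟨i, hi⟩
      rw [hmap, hmap] at this
      exact_mod_cast this
    by_cases hi : b.IsPos i
    · exact key i hi
    · have := key _ ((isPos_reflectionPerm_self b i).2 hi)
      rw [((isAlcoveFamily_baseFamily b).act v).neg,
        ((isAlcoveFamily_baseFamily b).act w).neg] at this
      exact (sub_right_inj).1 this
  · obtain ⟨k, hk, hx⟩ := mem_integralPoints_shiVariety.1 hx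
    obtain ⟨w, -, hw⟩ := exists_mem_wallGroup (b := b) hk.extend
    refine ⟨w, Set.mem_univ w, funext fun α => ?_⟩
    rw [hmap, hw, extend_of_pos, hx]

end Varieties

end ShiVariety

namespace ShiVariety

/-! ### Irreducibility of affine space and continuity of polynomial maps. -/

section Zariski

variable {σ τ : Type*}

theorem isIrreducible_univ_zariski :
    @IsIrreducible _ (zariskiTopology σ) (Set.univ : Set (σ → ℝ)) := by
  let _ := zariskiTopology σ
  refine ⟨Set.univ_nonempty, isPreirreducible_iff_isClosed_union_isClosed.2 ?_⟩
  intro Y Z hY hZ h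
  obtain ⟨I, rfl⟩ := isClosed_iff_zariski.1 hY
  obtain ⟨J, rfl⟩ := isClosed_iff_zariski.1 hZ
  by_contra! hcon
  obtain ⟨h₁, h₂⟩ := hcon
  obtain ⟨x, -, hx⟩ := Set.not_subset.1 h₁
  obtain ⟨y, -, hy⟩ := Set.not_subset.1 h₂
  simp only [zeroSet, Set.mem_ofPred_eq, not_forall] at hx hy
  obtain ⟨p, hp, hpx⟩ := hx
  obtain ⟨q, hq, hqy⟩ := hy
  -- The product vanishes at every real point, and ℝ is an infinite domain.
  have hpq : p * q = 0 := by
    refine MvPolynomial.funext fun z => ?_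
    have hz : z ∈ zeroSet (I * J) := by
      rw [zeroSet_mul]
      exact h (Set.mem_univ z)
    have := hz _ (Ideal.mul_mem_mul hp hq)
    simpa [MvPolynomial.aeval_eq_eval] using this
  rcases mul_eq_zero.1 hpq with h | h
  · exact hpx (by rw [h, map_zero])
  · exact hqy (by rw [h, map_zero])

theorem continuous_zariski (f : τ → MvPolynomial σ ℝ) :
    @Continuous _ _ (zariskiTopology σ) (zariskiTopology τ)
      fun x i => MvPolynomial.aeval x (f i) := by
  let _ := zariskiTopology σ
  let _ := zariskiTopology τ
  refine continuous_iff_isClosed.2 fun Y hY => ?_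
  obtain ⟨I, rfl⟩ := isClosed_iff_zariski.1 hY
  refine isClosed_iff_zariski.2 ⟨I.map (MvPolynomial.bind₁ f), ?_⟩
  have h : ∀ (x : σ → ℝ) p, MvPolynomial.aeval x (MvPolynomial.bind₁ f p) =
      MvPolynomial.aeval (fun i => MvPolynomial.aeval x (f i)) p := fun x p =>
    MvPolynomial.aeval_bind₁ x f p
  ext x
  constructor
  · intro hx p hp
    have hle : I.map (MvPolynomial.bind₁ f) ≤ RingHom.ker (MvPolynomial.aeval (R := ℝ) x) := by
      rw [Ideal.map_le_iff_le_comap]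
      intro q hq
      rw [Ideal.mem_comap, RingHom.mem_ker]
      exact (h x q).trans (hx q hq)
    exact RingHom.mem_ker.1 (hle hp)
  · intro hx p hp
    rw [← h]
    exact hx _ (Ideal.mem_map_of_mem _ hp)

end Zariski

variable {ι M N : Type*} [AddCommGroup M] [Module ℝ M] [AddCommGroup N] [Module ℝ N]
variable {P : RootPairing ι ℝ M N} {b : P.Base}

/-! ### Irreducible components, admitted vectors and box families. -/

section Components

/-- The parametrization of `X[v]` by its coordinates at the simple roots. -/
noncomputable def varXAtParam (v : PosRoot b → ℤ) (y : b.support → ℝ) : PosRoot b → ℝ :=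
  fun α => ∑ s : b.support, (corootCoeff b α s : ℝ) * y s + v α

theorem varXAtParam_simple {v : PosRoot b → ℤ} (hv : IsAdmissible b v) (y : b.support → ℝ)
    (s : b.support) : varXAtParam v y (simple b s) = y s := by
  classical
  have : ∀ t : b.support, corootCoeff b (simple b s) t = if s = t then 1 else 0 :=
    corootCoeff_simple b s
  simp [varXAtParam, this, hv.simple]

theorem range_varXAtParam {v : PosRoot b → ℤ} (hv : IsAdmissible b v) :
    Set.range (varXAtParam v) = varXAt b v := by
  ext x
  rw [mem_varXAt]
  constructor
  · rintro ⟨y, rfl⟩ α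
    simp only [varXAtParam_simple hv]
    rfl
  · exact fun h => ⟨fun s => x (simple b s), funext fun α => (h α).symm⟩

theorem continuous_varXAtParam (v : PosRoot b → ℤ) :
    @Continuous _ _ (zariskiTopology _) (zariskiTopology _) (varXAtParam v) := by
  convert! continuous_zariski fun α : PosRoot b =>
    (∑ s : b.support, MvPolynomial.C (corootCoeff b α s : ℝ) * MvPolynomial.X s +
      MvPolynomial.C (v α : ℝ) : MvPolynomial b.support ℝ) using 1
  funext y α
  simp [varXAtParam]

variable [Finite ι]

/-- Each piece is a polynomial image of an affine space, so irreducible. An irreducible subset lies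
in one of the finitely many closed pieces, and disjointness makes every piece maximal. -/
theorem components_shiVariety (b : P.Base) : components (shiVariety b) =
    (fun v => Subtype.val ⁻¹' varXAt b v) '' {v | IsAdmitted b v} := by
  let _ := zariskiTopology (PosRoot b)
  have hirr : ∀ v, IsAdmitted b v →
      IsIrreducible (Subtype.val ⁻¹' varXAt b v : Set (shiVariety b)) := by
    intro v hv
    have hsub : ∀ y, varXAtParam v y ∈ shiVariety b := fun y =>
      Set.mem_iUnion₂.2 ⟨v, hv, range_varXAtParam hv.1 ▸ ⟨y, rfl⟩⟩
    have hr : (Subtype.val ⁻¹' varXAt b v : Set (shiVariety b)) =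
        (fun y => ⟨varXAtParam v y, hsub y⟩) '' Set.univ := by
      ext ⟨x, hx⟩
      rw [Set.mem_preimage, ← range_varXAtParam hv.1, Set.image_univ]
      simp [Subtype.ext_iff]
    rw [hr]
    let _ := zariskiTopology b.support
    refine isIrreducible_univ_zariski.image _ (Continuous.continuousOn ?_)
    exact (continuous_varXAtParam v).subtype_mk _
  have hmem : ∀ t : Set (shiVariety b), IsIrreducible t →
      ∃ v, IsAdmitted b v ∧ t ⊆ Subtype.val ⁻¹' varXAt b v := by
    intro t ht
    classical
    have hfin := (finite_isAdmitted b).image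
      fun v => (Subtype.val ⁻¹' varXAt b v : Set (shiVariety b))
    obtain ⟨z, hz, htz⟩ := isIrreducible_iff_sUnion_isClosed.1 ht hfin.toFinset (by
      intro z hz
      rw [Set.Finite.mem_toFinset] at hz
      obtain ⟨v, -, rfl⟩ := hz
      exact (isClosed_varXAt v).preimage continuous_subtype_val) (by
      rintro ⟨x, hx⟩ -
      obtain ⟨v, hv, hxv⟩ := Set.mem_iUnion₂.1 hx
      rw [Set.Finite.coe_toFinset]
      exact ⟨_, ⟨v, hv, rfl⟩, hxv⟩)
    rw [Set.Finite.mem_toFinset] at hz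
    obtain ⟨v, hv, rfl⟩ := hz
    exact ⟨v, hv, htz⟩
  ext t
  constructor
  · intro ht
    obtain ⟨v, hv, hsub⟩ := hmem t ht.1
    exact ⟨v, hv, (ht.2 (hirr v hv) hsub).antisymm hsub⟩
  · rintro ⟨v, hv, rfl⟩
    refine ⟨hirr v hv, fun t ht hle => ?_⟩
    obtain ⟨v', hv', hsub⟩ := hmem t ht
    obtain ⟨x, hx⟩ := (hirr v hv).1
    rw [eq_of_mem_varXAt hx (hsub (hle hx))]
    exact hsub

theorem ncard_components_shiVariety (b : P.Base) :
    (components (shiVariety b)).ncard = {v | IsAdmitted b v}.ncard := by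
  rw [components_shiVariety]
  refine Set.InjOn.ncard_image fun v hv v' hv' h => ?_
  have h0 : varXAtParam v 0 ∈ varXAt b v := range_varXAtParam hv.1 ▸ ⟨0, rfl⟩
  have hx : (⟨_, Set.mem_iUnion₂.2 ⟨v, hv, h0⟩⟩ : shiVariety b) ∈
      (Subtype.val ⁻¹' varXAt b v : Set (shiVariety b)) := h0
  have hx' := hx
  beta_reduce at h
  rw [h] at hx'
  exact eq_of_mem_varXAt hx hx'

variable [P.IsCrystallographic] [P.IsReduced]

variable (b) in
/-- The alcove families of the alcoves contained in the box `0 < ⟨x, α_i^∨⟩ < 1`. -/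
def BoxFamily : Type _ := {K : ι → ℤ // IsAlcoveFamily P K ∧ ∀ s : b.support, K s = 0}

variable (b) in
/-- Admitted vectors are the restrictions to the positive roots of the alcove families of the
box. -/
noncomputable def admittedEquivBoxFamily : {v | IsAdmitted b v} ≃ BoxFamily b where
  toFun v := ⟨extend b v.1, v.2.2.extend, fun s =>
    (extend_of_pos v.1 (simple b s)).trans (v.2.1.simple s)⟩
  invFun K := ⟨fun α => K.1 α, (K.2.1.satisfiesShiSystem b).isAdmissible
    (fun s => K.2.2 s), K.2.1.satisfiesShiSystem b⟩
  left_inv v := Subtype.ext (funext fun α => extend_of_pos _ α)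
  right_inv K := Subtype.ext (funext fun i => by
    by_cases h : b.IsPos i
    · exact extend_of_pos _ ⟨i, h⟩
    · change extend b _ i = K.1 i
      rw [extend, dif_neg h, K.2.1.neg]
      ring)

instance : Finite (BoxFamily b) :=
  have := (finite_isAdmitted b).to_subtype
  .of_equiv _ (admittedEquivBoxFamily b)

variable (b) in
theorem ncard_isAdmitted : {v | IsAdmitted b v}.ncard = Nat.card (BoxFamily b) :=
  Nat.card_congr (admittedEquivBoxFamily b)

end Components

/-! ### Box families, the Cartan determinant and the finite reflection group. -/

section Counting

variable (b) in
/-- Translation of a family of integers by a vector with integral coordinates. -/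
noncomputable def translate (K : ι → ℤ) (x : b.support → ℤ) : ι → ℤ :=
  fun i => K i + ∑ s, corootCoeff b i s * x s

theorem IsAlcoveFamily.translate {K : ι → ℤ} (hK : IsAlcoveFamily P K) (x : b.support → ℤ) :
    IsAlcoveFamily P (translate b K x) where
  neg i := by
    simp only [ShiVariety.translate, hK.neg, corootCoeff_neg, neg_mul, Finset.sum_neg_distrib]
    ring
  add i j l h := by
    have := hK.add i j l h
    simp only [ShiVariety.translate, corootCoeff_add b h, add_mul, Finset.sum_add_distrib]
    constructor <;> linarith

theorem translate_simple (K : ι → ℤ) (x : b.support → ℤ) (s : b.support) :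
    translate b K x s = K s + x s := by
  classical
  simp [translate, corootCoeff_simple]

theorem translate_translate (K : ι → ℤ) (x y : b.support → ℤ) :
    translate b (translate b K x) y = translate b K (x + y) := by
  funext i
  simp only [translate, Pi.add_apply, mul_add, Finset.sum_add_distrib]
  ring

theorem translate_zero (K : ι → ℤ) : translate b K 0 = K := by
  funext i
  simp [translate]

variable [P.IsCrystallographic]

theorem exists_translation {q : M} (hq : q ∈ P.rootSpan ℤ) :
    ∃ u : affineWeylGroup P, indexPerm u = 1 ∧ ∀ i, (shift u i : ℝ) = P.coroot' i q := by
  let S : AddSubgroup M :=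
    { carrier := {q | ∃ u : affineWeylGroup P, indexPerm u = 1 ∧
        ∀ i, (shift u i : ℝ) = P.coroot' i q}
      zero_mem' := ⟨1, indexPerm_one, fun i => by simp [shift_one]⟩
      add_mem' := by
        rintro q r ⟨u, hu, hu'⟩ ⟨v, hv, hv'⟩
        refine ⟨u * v, by rw [indexPerm_mul, hu, hv, mul_one], fun i => ?_⟩
        rw [shift_mul, hu, map_add, Int.cast_add, hu', Equiv.Perm.one_apply, hv', add_comm]
      neg_mem' := by
        rintro q ⟨u, hu, hu'⟩
        obtain ⟨h₁, h₂⟩ := (isAffineSymmetry u⁻¹).unique (isAffineSymmetry u).inv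
        refine ⟨u⁻¹, by rw [h₁, hu, inv_one], fun i => ?_⟩
        rw [h₂, hu, map_neg, ← hu']
        simp }
  have hle : P.rootSpan ℤ ≤ S.toIntSubmodule := by
    rw [RootPairing.rootSpan, Submodule.span_le]
    rintro _ ⟨a, rfl⟩
    -- The product of these two parallel reflections is translation by the root a.
    refine ⟨refl P a 1 * refl P a 0, ?_, fun i => ?_⟩
    · rw [indexPerm_mul, indexPerm_refl, indexPerm_refl, ← sq, P.reflectionPerm_sq]
    · rw [shift_mul, shift_refl, shift_refl, coroot'_root]
      simp
  exact hle hq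

variable (P) in
/-- The Cartan matrix, acting on integral coordinates. -/
noncomputable def cartan (b : P.Base) : Matrix b.support b.support ℤ := fun s t => P.pairingIn ℤ t s

/-- The range of the Cartan matrix is the root lattice in the coordinates ⟨·, α_s^∨⟩, so the
quotient below is weight lattice modulo root lattice. -/
theorem mem_range_cartan {x : b.support → ℤ} :
    x ∈ LinearMap.range (cartan P b).mulVecLin ↔
      ∃ q ∈ P.rootSpan ℤ, ∀ s : b.support, P.coroot' s q = x s := by
  have key : ∀ (z : b.support → ℤ) (s : b.support),
      P.coroot' s (∑ t : b.support, z t • P.root t) = (cartan P b).mulVecLin z s := by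
    intro z s
    simp only [map_sum, map_zsmul, coroot'_root, Matrix.mulVecLin_apply, Matrix.mulVec,
      dotProduct, cartan, zsmul_eq_mul]
    push_cast
    exact Finset.sum_congr rfl fun t _ => mul_comm _ _
  constructor
  · rintro ⟨z, rfl⟩
    exact ⟨∑ t : b.support, z t • P.root t, Submodule.sum_mem _ fun t _ => Submodule.smul_mem _ _
      (Submodule.subset_span ⟨t, rfl⟩), key z⟩
  · rintro ⟨q, hq, hx⟩
    have hz : ∃ z : b.support → ℤ, q = ∑ t : b.support, z t • P.root t := by
      refine ⟨fun t => b.toWeightBasisInt.repr ⟨q, hq⟩ t, ?_⟩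
      have h := congrArg (Submodule.subtype _) (b.toWeightBasisInt.sum_repr ⟨q, hq⟩)
      simp only [map_sum, map_smul, Submodule.subtype_apply,
        RootPairing.Base.coe_toWeightBasisInt_apply] at h
      exact h.symm
    obtain ⟨z, rfl⟩ := hz
    refine ⟨z, funext fun s => ?_⟩
    have := (key z s).symm.trans (hx s)
    exact_mod_cast this

theorem cartan_mulVec_injective [P.IsRootSystem] :
    Function.Injective (cartan P b).mulVecLin := by
  rw [← LinearMap.ker_eq_bot, LinearMap.ker_eq_bot']
  intro z hz
  have h : ∑ t : b.support, z t • P.root t = 0 := by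
    refine (coords b).injective (funext fun s => ?_)
    rw [coords_apply, map_zero]
    have := congrArg (fun n : ℤ => (n : ℝ)) (congrFun hz s)
    simp only [Matrix.mulVecLin_apply, Matrix.mulVec, dotProduct, cartan, Pi.zero_apply] at this
    simp only [map_sum, map_zsmul, coroot'_root, zsmul_eq_mul]
    push_cast at this
    refine Eq.trans ?_ this
    exact Finset.sum_congr rfl fun t _ => mul_comm _ _
  funext t
  exact Fintype.linearIndependent_iff.1 (b.linearIndepOn_root.restrict_scalars' ℤ) z h t

theorem card_quotient_cartan [P.IsRootSystem] [DecidableEq b.support] :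
    Nat.card ((b.support → ℤ) ⧸ LinearMap.range (cartan P b).mulVecLin) =
      (cartan P b).det.natAbs := by
  rw [← Submodule.natAbs_det_equiv _ (LinearEquiv.ofInjective _ cartan_mulVec_injective)]
  congr 1
  rw [← LinearMap.det_toLin']
  rfl

theorem cartan_flip : cartan P.flip b.flip = (cartan P b).transpose := by
  ext s t
  have h : ((P.flip.pairingIn ℤ t s : ℤ) : ℝ) = P.pairingIn ℤ s t := by
    have h₁ := P.flip.algebraMap_pairingIn ℤ t s
    have h₂ := P.algebraMap_pairingIn ℤ s t
    rw [RootPairing.pairing_flip, ← h₂] at h₁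
    simpa using h₁
  exact_mod_cast h

variable [Finite ι] [P.IsReduced] [P.IsRootSystem]

variable (P) in
/-- The group of permutations of the roots generated by the reflections. -/
def reflectionPermGroup : Subgroup (Equiv.Perm ι) :=
  Subgroup.closure (Set.range P.reflectionPerm)

variable (b) in
-- W_a surjects onto both sides. One map translates the alcove of w into the box and keeps the class
-- of its simple coordinates modulo the root lattice; the other keeps the linear part of w. Two
-- elements have the same image, under either map, exactly when they differ by a translation in the
-- root lattice.
theorem card_boxFamily_mul :
    Nat.card (BoxFamily b) *
      Nat.card ((b.support → ℤ) ⧸ LinearMap.range (cartan P b).mulVecLin) =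
      Nat.card (reflectionPermGroup P) := by
  have := Fintype.ofFinite ι
  set Q := LinearMap.range (cartan P b).mulVecLin with hQ
  let fam : affineWeylGroup P → ι → ℤ := fun w => act w (baseFamily b)
  let co : affineWeylGroup P → b.support → ℤ := fun w s => fam w s
  have hfam : ∀ w, IsAlcoveFamily P (fam w) := fun w => (isAlcoveFamily_baseFamily b).act w
  let Ψ : affineWeylGroup P → BoxFamily b × ((b.support → ℤ) ⧸ Q) := fun w =>
    (⟨translate b (fam w) (-co w), (hfam w).translate _, fun s => by
      rw [translate_simple]; exact add_neg_cancel _⟩, Submodule.Quotient.mk (co w))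
  let π₀ : affineWeylGroup P → reflectionPermGroup P := fun w =>
    ⟨indexPerm w, (isAffineSymmetry w).perm_mem⟩
  have hΨ : Function.Surjective Ψ := by
    rintro ⟨K, x⟩
    obtain ⟨x, rfl⟩ := Submodule.Quotient.mk_surjective Q x
    obtain ⟨w, -, hw⟩ := exists_mem_wallGroup (b := b) (K.2.1.translate x)
    have hco : co w = x := funext fun s => by
      change act w (baseFamily b) s = x s
      rw [hw, translate_simple, K.2.2, zero_add]
    refine ⟨w, Prod.ext (Subtype.ext ?_) ?_⟩
    · change translate b (act w (baseFamily b)) (-co w) = K.1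
      rw [hw, hco, translate_translate, add_neg_cancel, translate_zero]
    · change Submodule.Quotient.mk (co w) = _
      rw [hco]
  have hπ₀ : Function.Surjective π₀ := by
    rintro ⟨ρ, hρ⟩
    suffices h : ∃ w : affineWeylGroup P, indexPerm w = ρ by
      obtain ⟨w, rfl⟩ := h
      exact ⟨w, rfl⟩
    induction hρ using Subgroup.closure_induction with
    | mem _ h =>
      obtain ⟨a, rfl⟩ := h
      exact ⟨refl P a 0, indexPerm_refl a 0⟩
    | one => exact ⟨1, indexPerm_one⟩
    | mul _ _ _ _ h₁ h₂ =>
      obtain ⟨v, rfl⟩ := h₁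
      obtain ⟨w, rfl⟩ := h₂
      exact ⟨w * v, indexPerm_mul w v⟩
    | inv _ _ h =>
      obtain ⟨v, rfl⟩ := h
      exact ⟨v⁻¹, ((isAffineSymmetry v⁻¹).unique (isAffineSymmetry v).inv).1⟩
  have hker : ∀ v w, Ψ v = Ψ w ↔ π₀ v = π₀ w := by
    intro v w
    have h₁ : Ψ v = Ψ w ↔ translate b (fam v) (-co v) = translate b (fam w) (-co w) ∧
        (Submodule.Quotient.mk (co v) : (b.support → ℤ) ⧸ Q) = Submodule.Quotient.mk (co w) :=
      Prod.ext_iff.trans (and_congr Subtype.ext_iff Iff.rfl)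
    rw [h₁, Subtype.ext_iff, Submodule.Quotient.eq, hQ, mem_range_cartan]
    change _ ↔ indexPerm v = indexPerm w
    clear h₁
    constructor
    · rintro ⟨h₁, q, hq, hx⟩
      obtain ⟨u, hu, hu'⟩ := exists_translation hq
      -- The alcoves of v and w differ by the translation u, and simple transitivity upgrades this
      -- to an identity in the group.
      suffices h : v = u * w by rw [h, indexPerm_mul, hu, mul_one]
      refine act_baseFamily_injective b (funext fun i => ?_)
      change fam v i = act (u * w) (baseFamily b) i
      have h₂ : fam v = translate b (fam w) (co v - co w) := by
        have := congrArg (fun K => translate b K (co v)) h₁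
        simp only [translate_translate, neg_add_cancel, translate_zero] at this
        rw [this, neg_add_eq_sub]
      have h₃ : (shift u i : ℝ) = ((∑ s, corootCoeff b i s * (co v - co w) s : ℤ) : ℝ) := by
        rw [hu', coroot'_eq_sum b, Int.cast_sum]
        exact Finset.sum_congr rfl fun s _ => by rw [hx, Int.cast_mul]
      rw [h₂, act_mul, act, hu, translate, Equiv.Perm.one_apply, Int.cast_injective h₃]
    · intro h
      have hv := isAffineSymmetry v
      have hw := isAffineSymmetry w
      set q : M := (v : M ≃ᵃ[ℝ] M) 0 - (w : M ≃ᵃ[ℝ] M) 0 with hq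
      have hqmem : q ∈ P.rootSpan ℤ :=
        sub_mem ((hv.lattice 0).2 (zero_mem _)) ((hw.lattice 0).2 (zero_mem _))
      have hdiff : ∀ i, P.coroot' i q = ((fam v i - fam w i : ℤ) : ℝ) := fun i => by
        have e : fam v i - fam w i = shift v i - shift w i := by
          change act v _ i - act w _ i = _
          rw [act, act, h]
          ring
        rw [e, hq, map_sub, ← hv.shift_eq, ← hw.shift_eq, Int.cast_sub]
      refine ⟨?_, q, hqmem, fun s => hdiff s⟩
      funext i
      have h₁ := (hdiff i).symm.trans (coroot'_eq_sum b i q)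
      simp only [hdiff] at h₁
      have h₂ : fam v i - fam w i = ∑ s : b.support, corootCoeff b i s * (fam v s - fam w s) := by
        exact_mod_cast h₁
      simp only [translate, Pi.neg_apply, mul_neg, Finset.sum_neg_distrib]
      simp only [mul_sub, Finset.sum_sub_distrib] at h₂
      change fam v i + -∑ s : b.support, corootCoeff b i s * fam v s =
        fam w i + -∑ s : b.support, corootCoeff b i s * fam w s
      linarith
  rw [← Nat.card_prod, ← Nat.card_congr (Setoid.quotientKerEquivOfSurjective Ψ hΨ),
    ← Nat.card_congr (Setoid.quotientKerEquivOfSurjective π₀ hπ₀)]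
  rw [show Setoid.ker Ψ = Setoid.ker π₀ from Setoid.ext fun v w => hker v w]

/-- Passing to the dual transposes the Cartan matrix and leaves the reflection permutations as they
are, so the other two factors in `card_boxFamily_mul` agree. -/
theorem card_boxFamily_flip : Nat.card (BoxFamily b) = Nat.card (BoxFamily b.flip) := by
  classical
  have h₁ := card_boxFamily_mul b
  have h₂ := card_boxFamily_mul b.flip
  have hperm : reflectionPermGroup P.flip = reflectionPermGroup P := rfl
  rw [hperm, ← h₁] at h₂
  have hcard : Nat.card ((b.support → ℤ) ⧸ LinearMap.range (cartan P b).mulVecLin) =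
      Nat.card ((b.flip.support → ℤ) ⧸ LinearMap.range (cartan P.flip b.flip).mulVecLin) := by
    rw [card_quotient_cartan]
    refine Eq.trans ?_ (card_quotient_cartan (P := P.flip) (b := b.flip)).symm
    rw [cartan_flip]
    exact congrArg Int.natAbs (Matrix.det_transpose (cartan P b)).symm
  have hpos : Nat.card (reflectionPermGroup P) ≠ 0 := Nat.card_pos.ne'
  rw [← hcard] at h₂
  rw [← h₁] at hpos
  exact (Nat.eq_of_mul_eq_mul_right (Nat.pos_of_ne_zero (right_ne_zero_of_mul hpos)) h₂).symm

end Counting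

end ShiVariety

namespace ShiVariety

/-! ### The volume of the corner simplex. -/

section Volume

theorem measure_eq_card_mul {E κ : Type*} [MeasurableSpace E] {μ : Measure E} [Fintype κ]
    {R : κ → Set E} {B : Set E} {V : ENNReal} (hR : ∀ i, MeasurableSet (R i))
    (hdisj : Pairwise fun i j => Disjoint (R i) (R j)) (hV : ∀ i, μ (R i) = V)
    (hsub : ∀ i, R i ⊆ B) (hnull : μ (B \ ⋃ i, R i) = 0) : μ B = Fintype.card κ * V := by
  have h : μ B = μ (⋃ i, R i) :=
    (measure_mono_ae (ae_le_set.2 hnull)).antisymm (measure_mono (Set.iUnion_subset hsub))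
  rw [h, measure_iUnion hdisj hR]
  simp [hV]

variable {κ : Type*} [Fintype κ]

/-- The open corner simplex. -/
def cornerSimplex (κ : Type*) [Fintype κ] : Set (κ → ℝ) :=
  {x : κ → ℝ | (∀ i, 0 < x i) ∧ ∑ i, x i < 1}

theorem volume_diagonal_preimage [DecidableEq κ] {c : κ → ℝ} (hc : ∀ i, c i ≠ 0)
    (S : Set (κ → ℝ)) :
    volume ((fun (x : κ → ℝ) i => c i * x i) ⁻¹' S) = ENNReal.ofReal |(∏ i, c i)⁻¹| * volume S := by
  have hdet : LinearMap.det (Matrix.toLin' (Matrix.diagonal c)) = ∏ i, c i := by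
    rw [LinearMap.det_toLin', Matrix.det_diagonal]
  have h := Measure.addHaar_preimage_linearMap (volume : Measure (κ → ℝ))
    (f := Matrix.toLin' (Matrix.diagonal c))
    (by rw [hdet]; exact Finset.prod_ne_zero_iff.2 fun i _ => hc i) S
  rw [hdet] at h
  rw [← h]
  congr 2
  funext x i
  rw [Matrix.toLin'_apply, Matrix.mulVec_diagonal]

theorem measurableSet_cornerSimplex : MeasurableSet (cornerSimplex κ) := by
  have h : cornerSimplex κ = (⋂ i, {x : κ → ℝ | 0 < x i}) ∩ {x | ∑ i, x i < 1} := by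
    ext x
    simp [cornerSimplex]
  rw [h]
  exact (MeasurableSet.iInter fun i => measurableSet_lt measurable_const
    (measurable_pi_apply i)).inter (measurableSet_lt
      (Finset.measurable_sum _ fun i _ => measurable_pi_apply i) measurable_const)

/-- Up to the coordinate hyperplanes, the unit ℓ¹ ball, of volume 2^n / n!, is the disjoint union of
the 2^n sign changes of the simplex. -/
theorem volume_cornerSimplex :
    volume (cornerSimplex κ) = ENNReal.ofReal (1 / (Fintype.card κ).factorial) := by
  classical
  have h := volume_sum_rpow_lt_one κ (p := 1) le_rfl
  simp only [Real.rpow_one, div_one] at h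
  rw [show (1 : ℝ) + 1 = (1 : ℕ) + 1 by norm_num, Real.Gamma_nat_eq_factorial,
    Real.Gamma_nat_eq_factorial, Nat.factorial_one, Nat.cast_one, mul_one] at h
  rw [measure_eq_card_mul (κ := κ → ℤˣ)
    (R := fun ε => (fun (x : κ → ℝ) i => ((ε i : ℤ) : ℝ) * x i) ⁻¹' cornerSimplex κ)
    (V := volume (cornerSimplex κ)), Fintype.card_fun, Fintype.card_units_int] at h
  · have h₂ : ENNReal.ofReal (2 ^ Fintype.card κ / (Fintype.card κ).factorial) =
        (2 ^ Fintype.card κ : ℕ) * ENNReal.ofReal (1 / (Fintype.card κ).factorial) := by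
      rw [div_eq_mul_one_div, ENNReal.ofReal_mul (by positivity)]
      congr 1
      rw [← ENNReal.ofReal_natCast]
      push_cast
      rfl
    rw [h₂] at h
    exact (ENNReal.mul_right_inj (by simp) (ENNReal.natCast_ne_top _)).1 h
  · intro ε
    exact measurableSet_cornerSimplex.preimage
      (measurable_pi_lambda _ fun i => (measurable_pi_apply i).const_mul _)
  · intro ε ε' hne
    refine Set.disjoint_left.2 fun x hx hx' => hne (funext fun i => ?_)
    have h₁ : 0 < ((ε i : ℤ) : ℝ) * x i := hx.1 i
    have h₂ : 0 < ((ε' i : ℤ) : ℝ) * x i := hx'.1 i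
    rcases Int.units_eq_one_or (ε i) with e | e <;> rcases Int.units_eq_one_or (ε' i) with e' | e'
      <;> rw [e] at h₁ ⊢ <;> rw [e'] at h₂ ⊢ <;> norm_num at h₁ h₂ <;> linarith
  · intro ε
    rw [volume_diagonal_preimage (c := fun i => ((ε i : ℤ) : ℝ)) fun i => by simp]
    have : |(∏ i, ((ε i : ℤ) : ℝ))⁻¹| = 1 := by
      rw [abs_inv, Finset.abs_prod, Finset.prod_eq_one fun i _ => ?_, inv_one]
      rcases Int.units_eq_one_or (ε i) with e | e <;> simp [e]
    rw [this, ENNReal.ofReal_one, one_mul]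
  · intro ε x hx
    refine lt_of_le_of_lt (le_of_eq (Finset.sum_congr rfl fun i _ => ?_)) hx.2
    change |x i| = ((ε i : ℤ) : ℝ) * x i
    have h₁ : 0 < ((ε i : ℤ) : ℝ) * x i := hx.1 i
    rcases Int.units_eq_one_or (ε i) with e | e <;> rw [e] at h₁ ⊢
    · rw [Units.val_one, Int.cast_one, one_mul] at h₁ ⊢
      exact abs_of_pos h₁
    · rw [Units.val_neg, Units.val_one, Int.cast_neg, Int.cast_one, neg_one_mul] at h₁ ⊢
      exact abs_of_neg (neg_pos.1 h₁)
  · have hz : volume (⋃ i, {x : κ → ℝ | x i = 0}) = 0 :=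
      measure_iUnion_null fun i => Measure.pi_hyperplane _ i 0
    refine measure_mono_null ?_ hz
    rintro x ⟨hx, hx'⟩
    by_contra hcon
    simp only [Set.mem_iUnion, Set.mem_ofPred_eq, not_exists] at hcon
    refine hx' (Set.mem_iUnion.2 ⟨fun i => if 0 < x i then 1 else -1, ?_⟩)
    have habs : ∀ i, (((if 0 < x i then 1 else -1 : ℤˣ) : ℤ) : ℝ) * x i = |x i| := fun i => by
      split_ifs with h
      · rw [abs_of_pos h]; simp
      · rw [abs_of_nonpos (not_lt.1 h)]; simp
    refine ⟨fun i => ?_, ?_⟩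
    · simp only [habs]
      exact abs_pos.2 (hcon i)
    · simp only [habs]
      exact hx

end Volume

end ShiVariety

namespace ShiVariety

variable {ι M N : Type*} [AddCommGroup M] [Module ℝ M] [AddCommGroup N] [Module ℝ N]
variable {P : RootPairing ι ℝ M N} [P.IsRootSystem] {b : P.Base}

/-! ### Invariance of volume under the affine Weyl group. -/

section Invariance

/-- The linear part is an involution, so its determinant is ±1. -/
theorem volume_coords_affineReflection (a : ι) (m : ℤ) (A : Set M) :
    volume (coords b '' (affineReflection P a m '' A)) = volume (coords b '' A) := by
  classical
  let L : (b.support → ℝ) →ₗ[ℝ] (b.support → ℝ) :=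
    (coords b : M →ₗ[ℝ] _) ∘ₗ (P.reflection a : M →ₗ[ℝ] M) ∘ₗ ((coords b).symm : _ →ₗ[ℝ] M)
  have hdet : |LinearMap.det L| = 1 := by
    have h₁ : LinearMap.det L = LinearMap.det (P.reflection a : M →ₗ[ℝ] M) :=
      LinearMap.det_conj _ (coords b)
    have h₂ : (P.reflection a : M →ₗ[ℝ] M) ∘ₗ (P.reflection a : M →ₗ[ℝ] M) = LinearMap.id := by
      ext x
      simp
    have h₃ := congrArg LinearMap.det h₂
    rw [LinearMap.det_comp, LinearMap.det_id, ← sq, ← h₁] at h₃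
    rcases mul_self_eq_one_iff.1 ((sq _).symm.trans h₃) with h | h <;> simp [h]
  have himg : coords b '' (affineReflection P a m '' A) =
      (fun y => coords b ((m : ℝ) • P.root a) + y) '' (L '' (coords b '' A)) := by
    simp only [Set.image_image]
    refine Set.image_congr fun x _ => ?_
    simp [L, affineReflection, AffineEquiv.constVAdd_apply]
  rw [himg, Set.image_add_left, measure_preimage_add, Measure.addHaar_image_linearMap, hdet,
    ENNReal.ofReal_one, one_mul]

theorem volume_coords_image (w : affineWeylGroup P) (A : Set M) :
    volume (coords b '' ((w : M ≃ᵃ[ℝ] M) '' A)) = volume (coords b '' A) := by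
  obtain ⟨g, hg⟩ := w
  change volume (coords b '' (g '' A)) = _
  induction hg using Subgroup.closure_induction generalizing A with
  | mem _ h =>
    obtain ⟨a, m, rfl⟩ := h
    exact volume_coords_affineReflection a m A
  | one => exact congrArg (fun S => volume (coords b '' S)) (Set.image_id A)
  | mul g h _ _ hg hh =>
    rw [← hh A, ← hg (h '' A), Set.image_image g h]
    rfl
  | inv g _ hg =>
    rw [← hg ((g⁻¹ : M ≃ᵃ[ℝ] M) '' A), Set.image_image g]
    congr 2
    refine Eq.trans (Set.image_congr fun x _ => ?_) (Set.image_id A)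
    exact g.apply_symm_apply x

end Invariance

/-! ### Counting the alcoves of the box by volume. -/

section Count

theorem measurableSet_coords_region [Finite ι] (K : ι → ℤ) :
    MeasurableSet (coords b '' region P K) := by
  have h : coords b '' region P K =
      ⋂ i, {y : b.support → ℝ | (K i : ℝ) < ∑ s, (corootCoeff b i s : ℝ) * y s} ∩
        {y : b.support → ℝ | ∑ s, (corootCoeff b i s : ℝ) * y s < K i + 1} := by
    ext y
    rw [LinearEquiv.image_eq_preimage_symm, Set.mem_preimage, Set.mem_iInter]
    refine forall_congr' fun i => ?_
    simp only [strip, Set.mem_ofPred_eq, coroot'_eq_sum b i, ← coords_apply,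
      LinearEquiv.apply_symm_apply, Set.mem_inter_iff]
  have hm : ∀ i, Measurable fun y : b.support → ℝ => ∑ s, (corootCoeff b i s : ℝ) * y s :=
    fun i => Finset.measurable_sum _ fun s _ => (measurable_pi_apply s).const_mul _
  rw [h]
  exact MeasurableSet.iInter fun i =>
    (measurableSet_lt measurable_const (hm i)).inter (measurableSet_lt (hm i) measurable_const)

theorem volume_coords_hyperplane (i : ι) (m : ℤ) :
    volume {y : b.support → ℝ | P.coroot' i ((coords b).symm y) = m} = 0 := by
  set f : (b.support → ℝ) →ₗ[ℝ] ℝ := P.coroot' i ∘ₗ ((coords b).symm : _ →ₗ[ℝ] M) with hf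
  -- Halved because a root pairs to 2 with its own coroot; this is a base point of the affine
  -- hyperplane.
  set y₀ : b.support → ℝ := coords b (((m : ℝ) / 2) • P.root i) with hy₀
  have hroot : f (coords b (P.root i)) = 2 := by simp [hf]
  have hy : f y₀ = m := by
    rw [hy₀, map_smul, map_smul, hroot, smul_eq_mul]
    ring
  have h : {y : b.support → ℝ | P.coroot' i ((coords b).symm y) = m} =
      (fun y => y + -y₀) ⁻¹' (LinearMap.ker f : Set (b.support → ℝ)) := by
    ext y
    rw [Set.mem_preimage, SetLike.mem_coe, LinearMap.mem_ker, map_add, map_neg, hy,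
      ← sub_eq_add_neg, sub_eq_zero]
    rfl
  rw [h, measure_preimage_add_right]
  refine Measure.addHaar_submodule _ _ fun htop => ?_
  have : coords b (P.root i) ∈ LinearMap.ker f := htop ▸ Submodule.mem_top
  rw [LinearMap.mem_ker, hroot] at this
  norm_num at this

variable [P.IsCrystallographic] [P.IsReduced] [Finite ι]

omit [P.IsRootSystem] [P.IsCrystallographic] [P.IsReduced] [Finite ι] in
theorem isAlcoveFamily_floor {x : M} (hx : ∀ i (m : ℤ), P.coroot' i x ≠ m) :
    IsAlcoveFamily P fun i => ⌊P.coroot' i x⌋ := by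
  have hlt : ∀ i, (⌊P.coroot' i x⌋ : ℝ) < P.coroot' i x := fun i =>
    (Int.floor_le _).lt_of_ne (hx i _).symm
  refine ⟨fun i => ?_, fun i j l h => ?_⟩
  · rw [coroot'_reflectionPerm_self, Int.floor_eq_iff]
    have h₁ := hlt i
    have h₂ := Int.lt_floor_add_one (P.coroot' i x)
    push_cast
    constructor <;> linarith
  · rw [(coroot_eq_add_iff i j l).1 h x]
    exact ⟨Int.le_floor_add _ _, by
      have := Int.le_floor_add_floor (P.coroot' i x) (P.coroot' j x)
      omega⟩

/-- Off the countably many null hyperplanes, floors of the coroot values place each point of the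
open unit box in exactly one box alcove, and all alcoves have the volume of A_e. -/
theorem one_eq_card_boxFamily_mul :
    1 = (Nat.card (BoxFamily b) : ENNReal) * volume (coords b '' fundamentalAlcove b) := by
  have := Fintype.ofFinite ι
  have := Fintype.ofFinite (BoxFamily b)
  have hbox : volume (Set.pi Set.univ fun _ : b.support => Set.Ioo (0 : ℝ) 1) = 1 := by
    rw [volume_pi_pi]
    simp
  rw [← hbox, Nat.card_eq_fintype_card]
  refine measure_eq_card_mul (κ := BoxFamily b) (R := fun K => coords b '' region P K.1)
    (fun K => measurableSet_coords_region K.1) (fun K L hne => ?_) (fun K => ?_) (fun K => ?_) ?_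
  · refine (Set.disjoint_image_iff (coords b).injective).2 (Set.disjoint_left.2 fun x hx hx' => ?_)
    exact hne (Subtype.ext (funext fun i =>
      (floor_of_mem_strip (hx i)).symm.trans (floor_of_mem_strip (hx' i))))
  · obtain ⟨w, -, hw⟩ := exists_mem_wallGroup (b := b) K.2.1
    change volume (coords b '' region P K.1) = _
    rw [← hw, ← image_region, volume_coords_image, fundamentalAlcove_eq]
  · rintro _ ⟨x, hx, rfl⟩ s -
    have h := hx s
    rw [K.2.2, strip, Set.mem_ofPred_eq] at h
    rw [coords_apply]
    simpa using h
  · have hnull : volume (⋃ p : ι × ℤ,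
        {y : b.support → ℝ | P.coroot' p.1 ((coords b).symm y) = p.2}) = 0 :=
      measure_iUnion_null fun p => volume_coords_hyperplane p.1 p.2
    refine measure_mono_null ?_ hnull
    rintro y ⟨hy, hy'⟩
    by_contra hcon
    simp only [Set.mem_iUnion, Set.mem_ofPred_eq, not_exists] at hcon
    have hx : ∀ i (m : ℤ), P.coroot' i ((coords b).symm y) ≠ m := fun i m => hcon (i, m)
    refine hy' (Set.mem_iUnion.2 ⟨⟨_, isAlcoveFamily_floor hx, fun s => ?_⟩,
      (coords b).symm y, fun i => ⟨?_, ?_⟩, (coords b).apply_symm_apply y⟩)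
    · have h := hy s (Set.mem_univ s)
      rw [Int.floor_eq_iff, ← coords_apply, LinearEquiv.apply_symm_apply]
      simpa using ⟨h.1.le, h.2⟩
    · exact (Int.floor_le _).lt_of_ne (hx i _).symm
    · exact Int.lt_floor_add_one _

/-- On points with positive simple coordinates the dominating coroot takes the largest value, so its
upper bound implies all the others. -/
theorem coords_fundamentalAlcove {θ : ι}
    (hθ : ∀ i s, corootCoeff b i s ≤ corootCoeff b θ s) :
    coords b '' fundamentalAlcove b = (fun (y : b.support → ℝ) s => (corootCoeff b θ s : ℝ) * y s) ⁻¹'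
      cornerSimplex b.support := by
  classical
  have hpos : ∀ s : b.support, 0 < (corootCoeff b θ s : ℝ) := fun s => by
    have := hθ s s
    rw [corootCoeff_simple, if_pos rfl] at this
    exact_mod_cast this
  have hθpos : b.IsPos θ := by
    by_contra hneg
    have h₁ := (isPos_flip b _).2 ((isPos_reflectionPerm_self b θ).2 hneg)
    have : Nonempty ι := ⟨θ⟩
    obtain ⟨s, hs⟩ := b.support_nonempty
    have h₃ := corootCoeff_nonneg h₁ ⟨s, hs⟩
    rw [corootCoeff_neg] at h₃
    have h₄ : 0 < corootCoeff b θ ⟨s, hs⟩ := by exact_mod_cast hpos ⟨s, hs⟩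
    omega
  ext y
  rw [LinearEquiv.image_eq_preimage_symm, Set.mem_preimage, Set.mem_preimage]
  have hval : ∀ i, P.coroot' i ((coords b).symm y) =
      ∑ s, (corootCoeff b i s : ℝ) * y s := fun i => by
    rw [coroot'_eq_sum b]
    simp only [← coords_apply, LinearEquiv.apply_symm_apply]
  have hmem : (coords b).symm y ∈ fundamentalAlcove b ↔ ∀ i, b.IsPos i →
      0 < ∑ s, (corootCoeff b i s : ℝ) * y s ∧ ∑ s, (corootCoeff b i s : ℝ) * y s < 1 := by
    simp only [fundamentalAlcove, Set.mem_iInter, strip, Set.mem_ofPred_eq, hval, Int.cast_zero,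
      zero_add, Subtype.forall]
  rw [hmem]
  constructor
  · intro h
    refine ⟨fun s => mul_pos (hpos s) ?_, (h θ hθpos).2⟩
    have := (h s (RootPairing.Base.isPos_of_mem_support s.2)).1
    simpa [corootCoeff_simple] using this
  · rintro ⟨h₁, h₂⟩ i hi
    have hy : ∀ s, 0 < y s := fun s => (mul_pos_iff_of_pos_left (hpos s)).1 (h₁ s)
    have hc : ∀ s, 0 ≤ (corootCoeff b i s : ℝ) := fun s => by
      exact_mod_cast corootCoeff_nonneg ((isPos_flip b i).2 hi) s
    refine ⟨?_, lt_of_le_of_lt (Finset.sum_le_sum fun s _ =>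
      mul_le_mul_of_nonneg_right (by exact_mod_cast hθ i s) (hy s).le) h₂⟩
    refine (Finset.sum_nonneg fun s _ => mul_nonneg (hc s) (hy s).le).lt_of_ne fun h0 => ?_
    have hz := (Finset.sum_eq_zero_iff_of_nonneg fun s _ =>
      mul_nonneg (hc s) (hy s).le).1 h0.symm
    have hh := corootHeight_pos ((isPos_flip b i).2 hi)
    rw [corootHeight, Finset.sum_eq_zero fun s hs => ?_] at hh
    · exact lt_irrefl _ hh
    · have := (mul_eq_zero.1 (hz s hs)).resolve_right (hy s).ne'
      exact_mod_cast this

theorem card_boxFamily_eq {θ : ι} (hθ : ∀ i s, corootCoeff b i s ≤ corootCoeff b θ s) :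
    (Nat.card (BoxFamily b) : ℤ) =
      (b.support.card.factorial : ℤ) * ∏ s : b.support, corootCoeff b θ s := by
  classical
  have hpos : ∀ s : b.support, 0 < (corootCoeff b θ s : ℝ) := fun s => by
    have := hθ s s
    rw [corootCoeff_simple, if_pos rfl] at this
    exact_mod_cast this
  have hprod : 0 < ∏ s : b.support, (corootCoeff b θ s : ℝ) := Finset.prod_pos fun s _ => hpos s
  have h := one_eq_card_boxFamily_mul (b := b)
  rw [coords_fundamentalAlcove hθ, volume_diagonal_preimage fun s => (hpos s).ne',
    volume_cornerSimplex, Fintype.card_coe, abs_of_pos (inv_pos.2 hprod),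
    ← ENNReal.ofReal_mul (inv_pos.2 hprod).le, ← ENNReal.ofReal_natCast,
    ← ENNReal.ofReal_mul (Nat.cast_nonneg _), ← ENNReal.ofReal_one,
    ENNReal.ofReal_eq_ofReal_iff zero_le_one (by positivity)] at h
  have hf : (0 : ℝ) < b.support.card.factorial := by positivity
  field_simp at h
  have h' : (Nat.card (BoxFamily b) : ℝ) =
      (b.support.card.factorial : ℝ) * ∏ s : b.support, (corootCoeff b θ s : ℝ) := by
    linarith
  exact_mod_cast h'

-- Linear independence of the simple roots identifies the differences of coefficients with the
-- natural numbers supplied by the highest root condition.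
omit [P.IsRootSystem] [P.IsCrystallographic] [P.IsReduced] [Finite ι] in
theorem IsHighestRoot.rootCoeff_le {θ : ι} (hθ : IsHighestRoot b θ) (i : ι) (s : b.support) :
    rootCoeff b i s ≤ rootCoeff b θ s := by
  have h := hθ i
  rw [← Submodule.span_nat_eq_addSubmonoidClosure, Submodule.mem_toAddSubmonoid,
    Fintype.mem_span_image_iff_exists_fun] at h
  obtain ⟨c, hc⟩ := h
  have hli := b.linearIndepOn_root.restrict_scalars' ℤ
  have := Fintype.linearIndependent_iffₛ.mp hli
    (fun s => (c s : ℤ)) (fun s => rootCoeff b θ s - rootCoeff b i s) (by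
      simp only [natCast_zsmul, sub_smul, Finset.sum_sub_distrib]
      refine hc.trans ?_
      rw [root_eq_sum b θ, root_eq_sum b i]
      rfl) s
  beta_reduce at this
  omega

theorem ncard_components_eq {θ : ι} (hθ : IsHighestRoot b θ) :
    ((components (shiVariety b)).ncard : ℤ) =
      (b.support.card.factorial : ℤ) * ∏ i : b.support, rootCoeff b θ i := by
  rw [ncard_components_shiVariety, ncard_isAdmitted, card_boxFamily_flip]
  -- In the dual system the coroot coefficients are the root coefficients of P, so the highest root
  -- provides the dominating coroot.
  exact card_boxFamily_eq (P := P.flip) (b := b.flip) (θ := θ) fun i s => hθ.rootCoeff_le i s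

end Count

end ShiVariety

theorem theorem4p7 {ι M N : Type*} [Finite ι] [AddCommGroup M] [Module ℝ M] [AddCommGroup N]
    [Module ℝ N] (P : RootPairing ι ℝ M N) [P.IsRootSystem] [P.IsCrystallographic] [P.IsReduced]
    [P.IsIrreducible] (b : P.Base) :
    -- the integers `k(w, α)` are well defined
    (∀ w : ShiVariety.affineWeylGroup P, ∃! k, ShiVariety.IsShiVector b w k) ∧
    -- the map `w ↦ (k(w, α))_α` sends `W_a` to the integral points of `X_{W_a}`
    Set.MapsTo (ShiVariety.shiMap b) Set.univ
      (ShiVariety.integralPoints (ShiVariety.varX b)) ∧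
    -- the Shi variety is a subvariety of `X_{W_a}`
    ShiVariety.shiVariety b ⊆ ShiVariety.varX b ∧
    (∃ I : Ideal (MvPolynomial (ShiVariety.PosRoot b) ℝ),
      ShiVariety.shiVariety b = ShiVariety.zeroSet I) ∧
    -- the union that defines it is disjoint
    Set.PairwiseDisjoint {v | ShiVariety.IsAdmitted b v} (ShiVariety.varXAt b) ∧
    -- the map `w ↦ (k(w, α))_α` is a bijection onto the integral points of the Shi variety
    Set.BijOn (ShiVariety.shiMap b) Set.univ
      (ShiVariety.integralPoints (ShiVariety.shiVariety b)) ∧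
    -- the number of irreducible components, with the coefficients of the highest root
    (∀ θ : ι, ShiVariety.IsHighestRoot b θ →
      (ShiVariety.components (ShiVariety.shiVariety b)).Finite ∧
      ((ShiVariety.components (ShiVariety.shiVariety b)).ncard : ℤ) =
        (b.support.card.factorial : ℤ) * ∏ i : b.support, ShiVariety.rootCoeff b θ i) := by
  refine ⟨fun w => ⟨_, (ShiVariety.isShiVector_iff b w _).2 rfl, fun k hk =>
      (ShiVariety.isShiVector_iff b w k).1 hk⟩,
    fun w hw => ⟨ShiVariety.shiVariety_subset_varX b ((ShiVariety.bijOn_shiMap b).mapsTo hw).1,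
      ((ShiVariety.bijOn_shiMap b).mapsTo hw).2⟩,
    ShiVariety.shiVariety_subset_varX b,
    ShiVariety.isClosed_iff_zariski.1 (ShiVariety.isClosed_shiVariety b),
    fun v _ v' _ hne => Set.disjoint_left.2 fun x hx hx' =>
      hne (ShiVariety.eq_of_mem_varXAt hx hx'),
    ShiVariety.bijOn_shiMap b, fun θ hθ => ⟨?_, ShiVariety.ncard_components_eq hθ⟩⟩
  rw [ShiVariety.components_shiVariety]
  exact (ShiVariety.finite_isAdmitted b).image _
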